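/- Let $\mathcal G=(V,E)$ be a finite connected simple graph with more than one vertex. Over $\mathbb Q$, let $$\mathcal M_{\mathcal G}=\Big(\Lambda(x_1,x_2,y_1,y_2,y_3,z)\otimes\Lambda(x_v,z_v\mid v\in V),\,d\Big)$$ be the free graded commutative algebra on generators of degrees $\deg x_1=8$, $\deg x_2=10$, $\deg y_1=33$, $\deg y_2=35$, $\deg y_3=37$, $\deg z=119$, $\deg x_v=40$, $\deg z_v=119$ $(v\in V)$, with the derivation $d$ of degree $+1$ given by $$d x_1=0,\quad d x_2=0,\quad d y_1=x_1^3x_2,\quad d y_2=x_1^2x_2^2,\quad d y_3=x_1x_2^3,\quad d x_v=0,$$ $$d z=y_1y_2x_1^4x_2^2-y_1y_3x_1^5x_2+y_2y_3x_1^6+x_1^{15}+x_2^{12},\qquad d z_v=x_v^3+\sum_{w:\,(v,w)\in E}x_vx_wx_2^4 .$$ Let $W$ be the graded vector space spanned by the generators. Then $\mathcal M_{\mathcal G}=(\Lambda W,d)$ is an elliptic minimal Sullivan algebra of formal dimension $208+80|V|$. Explicitly: * (Sullivan) $d^2=0$, $W^0=W^1=0$, every $W^r$ is finite-dimensional, and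 $d(W^r)\subset\Lambda(W^{<r})$ for all $r$; * (minimal) $d(W)\subset\Lambda^{\ge 2}W$; * (elliptic) $W$ and $H^*(\Lambda W,d)$ are finite-dimensional; * (formal dimension) with $n=208+80|V|$, $H^*(\Lambda W,d)$ is a Poincaré duality algebra with fundamental class in degree $n$: $H^i=0$ for $i>n$, $\dim H^n=1$, and the products $H^i\times H^{n-i}\to H^n$ are nondegenerate. -/

import Mathlib

universe u

namespace RatHom

open scoped DirectSum

/-! ### Commutative differential graded algebras over the rationals -/

/-- A commutative differential graded algebra over `ℚ`, graded in degrees `0, 1, 2, …`, with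
differential of degree `+1`. -/
structure CDGA where
  carrier : Type u
  [ring : Ring carrier]
  [alg : Algebra ℚ carrier]
  /-- The homogeneous elements of degree `n`. -/
  gr : ℕ → Submodule ℚ carrier
  one_mem : (1 : carrier) ∈ gr 0
  mul_mem : ∀ {m n : ℕ} {a b : carrier}, a ∈ gr m → b ∈ gr n → a * b ∈ gr (m + n)
  isInternal : DirectSum.IsInternal gr
  comm : ∀ {m n : ℕ} {a b : carrier}, a ∈ gr m → b ∈ gr n → a * b = (-1) ^ (m * n) * (b * a)
  d : carrier →ₗ[ℚ] carrier
  d_mem : ∀ {n : ℕ} {a : carrier}, a ∈ gr n → d a ∈ gr (n + 1)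
  leibniz : ∀ {n : ℕ} {a : carrier} (b : carrier), a ∈ gr n →
    d (a * b) = d a * b + (-1) ^ n * (a * d b)
  d_d : ∀ a : carrier, d (d a) = 0

attribute [instance] CDGA.ring CDGA.alg

instance : CoeSort CDGA.{u} (Type u) := ⟨CDGA.carrier⟩

/-! ### The free graded commutative algebra on a graded set of generators -/

/-- Graded commutativity of the generators. Over `ℚ` the case `i = j` with `deg i` odd says that
the square of an odd generator vanishes. -/
inductive FreeCGA.Rel {ι : Type u} (deg : ι → ℕ) : FreeAlgebra ℚ ι → FreeAlgebra ℚ ι → Prop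
  | swap (i j : ι) : FreeCGA.Rel deg (FreeAlgebra.ι ℚ i * FreeAlgebra.ι ℚ j)
      ((-1) ^ (deg i * deg j) * (FreeAlgebra.ι ℚ j * FreeAlgebra.ι ℚ i))

/-- `Λ W`, for `W` the graded rational vector space with basis `ι`, the basis element `i` having
degree `deg i`: the symmetric algebra on the even generators tensored with the exterior algebra on
the odd ones, presented by generators and relations. -/
def FreeCGA {ι : Type u} (deg : ι → ℕ) : Type u := RingQuot (FreeCGA.Rel deg)

namespace FreeCGA

variable {ι : Type u} {deg : ι → ℕ}

instance : Ring (FreeCGA deg) := inferInstanceAs (Ring (RingQuot (FreeCGA.Rel deg)))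

instance : Algebra ℚ (FreeCGA deg) := inferInstanceAs (Algebra ℚ (RingQuot (FreeCGA.Rel deg)))

/-- The generator with index `i`. -/
def gen (deg : ι → ℕ) (i : ι) : FreeCGA deg :=
  RingQuot.mkAlgHom ℚ (FreeCGA.Rel deg) (FreeAlgebra.ι ℚ i)

theorem gen_mul_gen (i j : ι) :
    gen deg i * gen deg j = (-1) ^ (deg i * deg j) * (gen deg j * gen deg i) := by
  have h := RingQuot.mkAlgHom_rel ℚ (FreeCGA.Rel.swap (deg := deg) i j)
  rw [map_mul, map_mul, map_mul, map_pow, map_neg, map_one] at h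
  exact h

/-- The algebra map determined by its values on the generators. -/
def lift {A : Type*} [Ring A] [Algebra ℚ A] (f : ι → A)
    (hf : ∀ i j, f i * f j = (-1) ^ (deg i * deg j) * (f j * f i)) : FreeCGA deg →ₐ[ℚ] A :=
  RingQuot.liftAlgHom ℚ ⟨FreeAlgebra.lift ℚ f, by
    rintro _ _ ⟨i, j⟩
    simpa using hf i j⟩

@[simp] theorem lift_gen {A : Type*} [Ring A] [Algebra ℚ A] (f : ι → A)
    (hf : ∀ i j, f i * f j = (-1) ^ (deg i * deg j) * (f j * f i)) (i : ι) :
    lift f hf (gen deg i) = f i := by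
  have h := RingQuot.liftAlgHom_mkAlgHom_apply ℚ (FreeAlgebra.lift ℚ f)
    (s := FreeCGA.Rel deg) (by
      rintro _ _ ⟨i, j⟩
      simpa using hf i j) (FreeAlgebra.ι ℚ i)
  rw [FreeAlgebra.lift_ι_apply] at h
  exact h

theorem hom_ext {A : Type*} [Ring A] [Algebra ℚ A] {f g : FreeCGA deg →ₐ[ℚ] A}
    (h : ∀ i, f (gen deg i) = g (gen deg i)) : f = g := by
  refine RingQuot.ringQuot_ext' ℚ f g (FreeAlgebra.hom_ext ?_)
  funext i
  exact h i

/-- The product of a list of generators. -/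
def mono (deg : ι → ℕ) (l : List ι) : FreeCGA deg := (l.map (gen deg)).prod

/-- The degree of a product of generators. -/
def wt (deg : ι → ℕ) (l : List ι) : ℕ := (l.map deg).sum

@[simp] theorem mono_nil : mono deg [] = 1 := rfl
@[simp] theorem mono_cons (i : ι) (l : List ι) : mono deg (i :: l) = gen deg i * mono deg l := by
  simp [mono]
theorem mono_append (l m : List ι) : mono deg (l ++ m) = mono deg l * mono deg m := by
  simp [mono]
@[simp] theorem wt_nil : wt deg [] = 0 := rfl
@[simp] theorem wt_cons (i : ι) (l : List ι) : wt deg (i :: l) = deg i + wt deg l := by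
  simp [wt]
theorem wt_append (l m : List ι) : wt deg (l ++ m) = wt deg l + wt deg m := by
  simp [wt]

/-- The elements of degree `n`: the span of the products of generators whose degrees add up
to `n`. -/
def gr (deg : ι → ℕ) (n : ℕ) : Submodule ℚ (FreeCGA deg) :=
  Submodule.span ℚ {a | ∃ l : List ι, wt deg l = n ∧ mono deg l = a}

theorem mono_mem (l : List ι) : mono deg l ∈ gr deg (wt deg l) :=
  Submodule.subset_span ⟨l, rfl, rfl⟩

theorem gen_mem (i : ι) : gen deg i ∈ gr deg (deg i) := by
  simpa using mono_mem (deg := deg) [i]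

theorem one_mem : (1 : FreeCGA deg) ∈ gr deg 0 := by
  simpa using mono_mem (deg := deg) []

theorem mul_mem {m n : ℕ} {a b : FreeCGA deg} (ha : a ∈ gr deg m) (hb : b ∈ gr deg n) :
    a * b ∈ gr deg (m + n) := by
  induction ha using Submodule.span_induction with
  | mem a ha =>
    obtain ⟨l, rfl, rfl⟩ := ha
    induction hb using Submodule.span_induction with
    | mem b hb =>
      obtain ⟨k, rfl, rfl⟩ := hb
      rw [← mono_append, ← wt_append]
      exact mono_mem _
    | zero => simp
    | add b c _ _ hb hc => rw [mul_add]; exact add_mem hb hc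
    | smul r b _ hb => rw [mul_smul_comm]; exact Submodule.smul_mem _ _ hb
  | zero => simp
  | add a c _ _ ha hc => rw [add_mul]; exact add_mem ha hc
  | smul r a _ ha => rw [smul_mul_assoc]; exact Submodule.smul_mem _ _ ha

instance : SetLike.GradedMonoid (gr deg) where
  one_mem := one_mem
  mul_mem _ _ _ _ := mul_mem

theorem sign_mul_comm {A : Type*} [Ring A] (k : ℕ) (a : A) : a * (-1) ^ k = (-1) ^ k * a :=
  ((Commute.neg_one_left a).pow_left k).eq.symm

theorem sign_even {A : Type*} [Ring A] {k : ℕ} (h : Even k) (a : A) : (-1) ^ k * a = a := by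
  rw [h.neg_one_pow, one_mul]

theorem sign_odd {A : Type*} [Ring A] {k : ℕ} (h : Odd k) (a : A) : (-1) ^ k * a = -a := by
  rw [h.neg_one_pow, neg_one_mul]

theorem sign_mem {A : Type*} [Ring A] [Algebra ℚ A] {S : Submodule ℚ A} (k : ℕ) {a : A}
    (h : a ∈ S) : (-1) ^ k * a ∈ S := by
  rcases neg_one_pow_eq_or A k with hk | hk <;> simp [hk, h]

theorem gen_mul_mono (i : ι) (l : List ι) :
    gen deg i * mono deg l = (-1) ^ (deg i * wt deg l) * (mono deg l * gen deg i) := by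
  induction l with
  | nil => simp
  | cons j l ih =>
    rw [mono_cons, wt_cons, ← mul_assoc, gen_mul_gen, mul_add, pow_add]
    simp only [mul_assoc]
    rw [ih, ← mul_assoc (gen deg j) ((-1) ^ _), sign_mul_comm]
    simp only [mul_assoc]

theorem mono_mul_mono (l m : List ι) :
    mono deg l * mono deg m = (-1) ^ (wt deg l * wt deg m) * (mono deg m * mono deg l) := by
  induction l with
  | nil => simp
  | cons i l ih =>
    rw [mono_cons, wt_cons, mul_assoc, ih, ← mul_assoc, sign_mul_comm, mul_assoc,
      ← mul_assoc (gen deg i), gen_mul_mono, add_mul, add_comm, pow_add]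
    simp only [mul_assoc]

theorem comm {m n : ℕ} {a b : FreeCGA deg} (ha : a ∈ gr deg m) (hb : b ∈ gr deg n) :
    a * b = (-1) ^ (m * n) * (b * a) := by
  induction ha using Submodule.span_induction with
  | mem a ha =>
    obtain ⟨l, rfl, rfl⟩ := ha
    induction hb using Submodule.span_induction with
    | mem b hb =>
      obtain ⟨k, rfl, rfl⟩ := hb
      exact mono_mul_mono l k
    | zero => simp
    | add b c _ _ hb hc => simp only [mul_add, add_mul, hb, hc]
    | smul r b _ hb => simp only [mul_smul_comm, smul_mul_assoc, hb]
  | zero => simp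
  | add a c _ _ ha hc => simp only [mul_add, add_mul, ha, hc]
  | smul r a _ ha => simp only [mul_smul_comm, smul_mul_assoc, ha]

theorem directSum_rel (i j : ι) :
    (DirectSum.of (fun n => gr deg n) (deg i) ⟨gen deg i, gen_mem i⟩ *
      DirectSum.of (fun n => gr deg n) (deg j) ⟨gen deg j, gen_mem j⟩ : ⨁ n, gr deg n) =
    (-1) ^ (deg i * deg j) *
      (DirectSum.of (fun n => gr deg n) (deg j) ⟨gen deg j, gen_mem j⟩ *
        DirectSum.of (fun n => gr deg n) (deg i) ⟨gen deg i, gen_mem i⟩) := by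
  have h := gen_mul_gen (deg := deg) i j
  rcases Nat.even_or_odd (deg i * deg j) with hk | hk
  · rw [hk.neg_one_pow, one_mul] at h
    refine Eq.trans ?_ (sign_even (A := ⨁ n, gr deg n) hk _).symm
    rw [DirectSum.of_mul_of,
      DirectSum.of_mul_of]
    exact DirectSum.of_eq_of_gradedMonoid_eq (Sigma.subtype_ext (add_comm _ _) h)
  · rw [hk.neg_one_pow, neg_one_mul] at h
    refine Eq.trans ?_ (sign_odd (A := ⨁ n, gr deg n) hk _).symm
    rw [DirectSum.of_mul_of,
      DirectSum.of_mul_of, ← map_neg]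
    exact DirectSum.of_eq_of_gradedMonoid_eq (Sigma.subtype_ext (add_comm _ _) h)

/-- The algebra map splitting an element into its homogeneous components. -/
def split (deg : ι → ℕ) : FreeCGA deg →ₐ[ℚ] ⨁ n, gr deg n :=
  lift (fun i => DirectSum.of (fun n => gr deg n) (deg i) ⟨gen deg i, gen_mem i⟩) directSum_rel

theorem split_mono (l : List ι) :
    split deg (mono deg l) = DirectSum.of (fun n => gr deg n) (wt deg l) ⟨mono deg l, mono_mem l⟩ := by
  induction l with
  | nil => exact map_one (split deg)
  | cons i l ih =>
    have h : split deg (mono deg (i :: l)) =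
        split deg (gen deg i) * split deg (mono deg l) := by rw [← map_mul, mono_cons]
    rw [h, ih, split, lift_gen, DirectSum.of_mul_of]
    exact DirectSum.of_eq_of_gradedMonoid_eq
      (Sigma.subtype_ext (wt_cons i l).symm (mono_cons i l).symm)

noncomputable instance : GradedAlgebra (gr deg) :=
  GradedAlgebra.ofAlgHom (gr deg) (split deg)
    (by
      refine hom_ext fun i => ?_
      simp [split])
    (by
      rintro n ⟨a, ha⟩
      induction ha using Submodule.span_induction with
      | mem a ha => obtain ⟨l, rfl, rfl⟩ := ha; exact split_mono l
      | zero =>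
        change split deg 0 = DirectSum.of (fun n => gr deg n) n 0
        simp
      | add a b ha hb h1 h2 =>
        change split deg (a + b) = DirectSum.of (fun n => gr deg n) n (⟨a, ha⟩ + ⟨b, hb⟩)
        rw [map_add, map_add]; exact congrArg₂ _ h1 h2
      | smul r a ha h1 =>
        change split deg (r • a) = DirectSum.lof ℚ ℕ (fun n => gr deg n) n (r • ⟨a, ha⟩)
        rw [map_smul, map_smul]; exact congrArg _ h1)

theorem isInternal (deg : ι → ℕ) : DirectSum.IsInternal (gr deg) :=
  DirectSum.Decomposition.isInternal (gr deg)

theorem induction_mono {p : FreeCGA deg → Prop} (a : FreeCGA deg) (h : ∀ l, p (mono deg l))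
    (h0 : p 0) (ha : ∀ a b, p a → p b → p (a + b)) (hs : ∀ (r : ℚ) a, p a → p (r • a)) : p a := by
  have ht : a ∈ ⨆ n, gr deg n := by
    rw [(isInternal deg).submodule_iSup_eq_top]; trivial
  induction ht using Submodule.iSup_induction' with
  | mem n a hn =>
    induction hn using Submodule.span_induction with
    | mem a ha => obtain ⟨l, -, rfl⟩ := ha; exact h l
    | zero => exact h0
    | add a b _ _ h1 h2 => exact ha _ _ h1 h2
    | smul r a _ h1 => exact hs _ _ h1
  | zero => exact h0
  | add a b _ _ h1 h2 => exact ha _ _ h1 h2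

/-! The derivation of degree `+1` with prescribed values `D` on the generators. It is the upper
right entry of the algebra map `a ↦ !![±a, d a; 0, a]`, where `±` is the parity sign. -/

theorem twist_rel (D : ι → FreeCGA deg) (hD : ∀ i, D i ∈ gr deg (deg i + 1)) (i j : ι) :
    (!![(-1) ^ deg i * gen deg i, D i; 0, gen deg i] *
        !![(-1) ^ deg j * gen deg j, D j; 0, gen deg j] : Matrix (Fin 2) (Fin 2) (FreeCGA deg)) =
      (-1) ^ (deg i * deg j) * (!![(-1) ^ deg j * gen deg j, D j; 0, gen deg j] *
        !![(-1) ^ deg i * gen deg i, D i; 0, gen deg i]) := by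
  have e : ∀ k : ℕ, ((-1) ^ k : Matrix (Fin 2) (Fin 2) (FreeCGA deg)) =
      !![(-1) ^ k, 0; 0, (-1) ^ k] := by
    intro k
    rcases Nat.even_or_odd k with h | h
    · rw [h.neg_one_pow, h.neg_one_pow, Matrix.one_fin_two]
    · rw [h.neg_one_pow, h.neg_one_pow, Matrix.one_fin_two]
      ext a b; fin_cases a <;> fin_cases b <;> simp
  have h1 := gen_mul_gen (deg := deg) i j
  have h2 := comm (gen_mem (deg := deg) i) (hD j)
  have h3 := comm (hD i) (gen_mem (deg := deg) j)
  rw [e, Matrix.mul_fin_two, Matrix.mul_fin_two, Matrix.mul_fin_two]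
  ext a b
  fin_cases a <;> fin_cases b
  all_goals simp only [Fin.zero_eta, Fin.mk_one, Matrix.of_apply, Matrix.cons_val',
    Matrix.cons_val_zero, Matrix.cons_val_one, Matrix.cons_val_fin_one, mul_zero, zero_mul,
    add_zero, zero_add]
  · rcases neg_one_pow_eq_or (FreeCGA deg) (deg i) with hi | hi <;>
    rcases neg_one_pow_eq_or (FreeCGA deg) (deg j) with hj | hj <;>
    simp [hi, hj, h1]
  · rw [mul_assoc, h2, h3]
    rw [mul_add (deg i), add_mul, mul_one, one_mul]
    simp only [pow_add, ← mul_assoc, mul_add]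
    rcases neg_one_pow_eq_or (FreeCGA deg) (deg i) with hi | hi <;>
    rcases neg_one_pow_eq_or (FreeCGA deg) (deg j) with hj | hj <;>
    simp [hi, hj, add_comm]
  · exact h1

variable (D : ι → FreeCGA deg) (hD : ∀ i, D i ∈ gr deg (deg i + 1))

/-- The algebra map `a ↦ !![±a, d a; 0, a]`. -/
def twist : FreeCGA deg →ₐ[ℚ] Matrix (Fin 2) (Fin 2) (FreeCGA deg) :=
  lift (fun i => !![(-1) ^ deg i * gen deg i, D i; 0, gen deg i]) (twist_rel D hD)

/-- The derivation of degree `+1` whose value on the generator `i` is `D i`. -/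
def derivation : FreeCGA deg →ₗ[ℚ] FreeCGA deg :=
  (Matrix.entryLinearMap ℚ (FreeCGA deg) 0 1).comp (twist D hD).toLinearMap

@[simp] theorem derivation_gen (i : ι) : derivation D hD (gen deg i) = D i := by
  simp [derivation, twist]

@[simp] theorem derivation_one : derivation D hD 1 = 0 := by
  simp [derivation]

theorem twist_mono (l : List ι) : twist D hD (mono deg l) =
    !![(-1) ^ wt deg l * mono deg l, derivation D hD (mono deg l); 0, mono deg l] := by
  have key : twist D hD (mono deg l) 0 0 = (-1) ^ wt deg l * mono deg l ∧
      twist D hD (mono deg l) 1 0 = 0 ∧ twist D hD (mono deg l) 1 1 = mono deg l := by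
    induction l with
    | nil => simp
    | cons i l ih =>
      obtain ⟨h1, h2, h3⟩ := ih
      rw [mono_cons, map_mul]
      simp only [Matrix.mul_apply, Fin.sum_univ_two, h1, h2, h3]
      simp only [twist, lift_gen]
      simp [pow_add, mul_assoc]
      rw [← mul_assoc (gen deg i), sign_mul_comm, mul_assoc]
  ext a b
  fin_cases a <;> fin_cases b
  · exact key.1
  · rfl
  · exact key.2.1
  · exact key.2.2

theorem derivation_mono_mul (l : List ι) (b : FreeCGA deg) :
    derivation D hD (mono deg l * b) =
      derivation D hD (mono deg l) * b + (-1) ^ wt deg l * (mono deg l * derivation D hD b) := by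
  induction b using induction_mono with
  | h m =>
    change (twist D hD (mono deg l * mono deg m)) 0 1 = _
    rw [map_mul, twist_mono, twist_mono, Matrix.mul_fin_two]
    simp [mul_assoc, add_comm]
  | h0 => simp
  | ha b c h1 h2 => simp only [mul_add, map_add, h1, h2]; abel
  | hs r b h1 => simp only [mul_smul_comm, map_smul, h1, smul_add]

theorem derivation_mul {n : ℕ} {a : FreeCGA deg} (b : FreeCGA deg) (ha : a ∈ gr deg n) :
    derivation D hD (a * b) =
      derivation D hD a * b + (-1) ^ n * (a * derivation D hD b) := by
  induction ha using Submodule.span_induction with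
  | mem a ha => obtain ⟨l, rfl, rfl⟩ := ha; exact derivation_mono_mul D hD l b
  | zero => simp
  | add a c _ _ h1 h2 => simp only [add_mul, mul_add, map_add, h1, h2]; abel
  | smul r a _ h1 => simp only [mul_smul_comm, smul_mul_assoc, map_smul, h1, smul_add]

theorem derivation_mem {n : ℕ} {a : FreeCGA deg} (ha : a ∈ gr deg n) :
    derivation D hD a ∈ gr deg (n + 1) := by
  induction ha using Submodule.span_induction with
  | mem a ha =>
    obtain ⟨l, rfl, rfl⟩ := ha
    induction l with
    | nil => simp
    | cons i l ih =>
      rw [mono_cons, derivation_mul D hD _ (gen_mem i), derivation_gen, wt_cons]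
      refine add_mem ?_ (sign_mem _ ?_)
      · have := mul_mem (hD i) (mono_mem (deg := deg) l)
        rwa [add_right_comm] at this
      · have := mul_mem (gen_mem (deg := deg) i) ih
        rwa [← add_assoc] at this
  | zero => simp
  | add a c _ _ h1 h2 => rw [map_add]; exact add_mem h1 h2
  | smul r a _ h1 => rw [map_smul]; exact Submodule.smul_mem _ _ h1

theorem derivation_derivation (h : ∀ i, derivation D hD (D i) = 0) (a : FreeCGA deg) :
    derivation D hD (derivation D hD a) = 0 := by
  induction a using induction_mono with
  | h l =>
    induction l with
    | nil => simp
    | cons i l ih =>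
      have hs : ∀ c : FreeCGA deg,
          derivation D hD ((-1) ^ deg i * c) = (-1) ^ deg i * derivation D hD c := by
        intro c
        rcases neg_one_pow_eq_or (FreeCGA deg) (deg i) with hi | hi <;> simp [hi]
      rw [mono_cons, derivation_mul D hD _ (gen_mem i), derivation_gen, map_add,
        derivation_mul D hD _ (hD i), h, hs, derivation_mul D hD _ (gen_mem i), ih,
        derivation_gen]
      rcases neg_one_pow_eq_or (FreeCGA deg) (deg i) with hi | hi <;> simp [pow_succ, hi]
  | h0 => simp
  | ha b c h1 h2 => simp [h1, h2]
  | hs r b h1 => simp [h1]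

/-- The commutative differential graded algebra `(Λ W, d)`, for a differential `d` given on the
generators. -/
def toCDGA (h : ∀ i, derivation D hD (D i) = 0) : CDGA.{u} where
  carrier := FreeCGA deg
  gr := gr deg
  one_mem := one_mem
  mul_mem := mul_mem
  isInternal := isInternal deg
  comm := comm
  d := derivation D hD
  d_mem := derivation_mem D hD
  leibniz := derivation_mul D hD
  d_d := derivation_derivation D hD h

end FreeCGA

/-! ### Cohomology, Poincaré duality, Sullivan algebras -/

namespace CDGA

variable (M : CDGA.{u})

/-- Cocycles of degree `n`. -/
def cocycles (n : ℕ) : Submodule ℚ M := M.gr n ⊓ LinearMap.ker M.d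

/-- Coboundaries of degree `n`. As `d` is homogeneous of degree `+1`, this is `d (M^{n-1})`. -/
def coboundaries (n : ℕ) : Submodule ℚ M := M.gr n ⊓ LinearMap.range M.d

/-- The cohomology `H^n(M)`. -/
abbrev Cohomology (n : ℕ) : Type u :=
  M.cocycles n ⧸ (M.coboundaries n).submoduleOf (M.cocycles n)

variable {M}

theorem mul_mem_cocycles {i j : ℕ} {a b : M} (ha : a ∈ M.cocycles i) (hb : b ∈ M.cocycles j) :
    a * b ∈ M.cocycles (i + j) := by
  refine ⟨M.mul_mem ha.1 hb.1, ?_⟩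
  have h1 : M.d a = 0 := ha.2
  have h2 : M.d b = 0 := hb.2
  simp [M.leibniz b ha.1, h1, h2]

theorem mul_mem_coboundaries {i j : ℕ} {a b : M} (ha : a ∈ M.cocycles i)
    (hb : b ∈ M.coboundaries j) : a * b ∈ M.coboundaries (i + j) := by
  refine ⟨M.mul_mem ha.1 hb.1, ?_⟩
  obtain ⟨c, rfl⟩ := hb.2
  have h1 : M.d a = 0 := ha.2
  have h : M.d (a * c) = (-1) ^ i * (a * M.d c) := by simp [M.leibniz c ha.1, h1]
  rcases neg_one_pow_eq_or M i with hi | hi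
  · exact ⟨a * c, by simpa [hi] using h⟩
  · exact ⟨-(a * c), by rw [map_neg, h, hi]; simp⟩

theorem coboundaries_mul_mem {i j : ℕ} {a b : M} (ha : a ∈ M.coboundaries i)
    (hb : b ∈ M.cocycles j) : a * b ∈ M.coboundaries (i + j) := by
  rw [M.comm ha.1 hb.1, add_comm]
  exact FreeCGA.sign_mem _ (mul_mem_coboundaries hb ha)

variable (M)

/-- The product of cocycles. -/
def cocycleMul (i j : ℕ) : M.cocycles i →ₗ[ℚ] M.cocycles j →ₗ[ℚ] M.cocycles (i + j) :=
  LinearMap.mk₂ ℚ (fun a b => ⟨(a : M) * (b : M), mul_mem_cocycles a.2 b.2⟩)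
    (fun _ _ _ => Subtype.ext (add_mul _ _ _))
    (fun _ _ _ => Subtype.ext (smul_mul_assoc _ _ _))
    (fun _ _ _ => Subtype.ext (mul_add _ _ _))
    (fun _ _ _ => Subtype.ext (mul_smul_comm _ _ _))

/-- The product `H^i(M) × H^j(M) → H^{i+j}(M)` induced by the multiplication of `M`. -/
def cup (i j : ℕ) : M.Cohomology i →ₗ[ℚ] M.Cohomology j →ₗ[ℚ] M.Cohomology (i + j) :=
  Submodule.liftQ _
    { toFun := fun a => Submodule.liftQ _
        ((Submodule.mkQ _).comp (M.cocycleMul i j a)) (fun b hb => by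
          simp only [LinearMap.mem_ker, LinearMap.comp_apply, Submodule.mkQ_apply,
            Submodule.Quotient.mk_eq_zero]
          exact mul_mem_coboundaries a.2 hb)
      map_add' := fun a a' => by ext b; simp
      map_smul' := fun r a => by ext b; simp }
    (fun a ha => by
      rw [LinearMap.mem_ker]
      ext b
      simp only [LinearMap.coe_mk, AddHom.coe_mk, LinearMap.comp_apply, Submodule.mkQ_apply,
        Submodule.liftQ_apply, LinearMap.zero_apply, Submodule.Quotient.mk_eq_zero]
      exact coboundaries_mul_mem ha b.2)

theorem cup_mk (i j : ℕ) (a : M.cocycles i) (b : M.cocycles j) :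
    M.cup i j (Submodule.Quotient.mk a) (Submodule.Quotient.mk b) =
      Submodule.Quotient.mk ⟨(a : M) * (b : M), mul_mem_cocycles a.2 b.2⟩ := rfl

/-- The cohomology of `M` is a Poincaré duality algebra `H = H^0 ⊕ ⋯ ⊕ H^n` of formal
dimension `n`: it is finite-dimensional, it vanishes above degree `n`, `H^n` is spanned by a single
nonzero class (the fundamental class), and the product pairings `H^i × H^{n-i} → H^n` are
nondegenerate. -/
structure HasFormalDimension (n : ℕ) : Prop where
  finite : ∀ i, Module.Finite ℚ (M.Cohomology i)
  vanish : ∀ i, n < i → Subsingleton (M.Cohomology i)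
  top : Module.finrank ℚ (M.Cohomology n) = 1
  nondegenerate_left : ∀ i j, i + j = n → ∀ a : M.Cohomology i, a ≠ 0 →
    ∃ b : M.Cohomology j, M.cup i j a b ≠ 0
  nondegenerate_right : ∀ i j, i + j = n → ∀ b : M.Cohomology j, b ≠ 0 →
    ∃ a : M.Cohomology i, M.cup i j a b ≠ 0

/-- As a graded commutative algebra, `M` is the free one `Λ W` on the graded subspace `W`: for
some homogeneous basis `b` of `W`, the canonical map from the free graded commutative algebra on
that basis to `M` is bijective. -/
def IsFreeOn (W : ℕ → Submodule ℚ M) : Prop :=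
  ∃ (ι : Type u) (deg : ι → ℕ) (b : ι → M) (hb : ∀ i, b i ∈ M.gr (deg i)),
    (∀ r, W r = Submodule.span ℚ {a | ∃ i, deg i = r ∧ b i = a}) ∧
    Function.Bijective
      (FreeCGA.lift (deg := deg) b (fun i j => M.comm (hb i) (hb j)))

/-- `M` is a Sullivan algebra `(Λ W, d)`: free as a graded commutative algebra on the simply
connected graded space `W`, of finite dimension in each degree, with `d (W^r) ⊆ Λ (W^{<r})`. -/
structure IsSullivan (W : ℕ → Submodule ℚ M) : Prop where
  simply_connected : ∀ r, r < 2 → W r = ⊥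
  finite_type : ∀ r, Module.Finite ℚ (W r)
  free : M.IsFreeOn W
  d_lower : ∀ r, ∀ w ∈ W r, M.d w ∈ Algebra.adjoin ℚ {a : M | ∃ s, s < r ∧ a ∈ W s}

/-- Minimality of `(Λ W, d)`: `d (W) ⊆ Λ^{≥ 2} W`, the span of the products `w * w' * a` with `w`
and `w'` in `W` and `a` in `Λ W`. -/
def IsMinimal (W : ℕ → Submodule ℚ M) : Prop :=
  ∀ r, ∀ w ∈ W r, M.d w ∈ (⨆ s, W s) * (⨆ s, W s) * (⊤ : Submodule ℚ M)

/-- Ellipticity of `(Λ W, d)`: both `W` and `H^*(Λ W)` are finite-dimensional. -/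
structure IsElliptic (W : ℕ → Submodule ℚ M) : Prop where
  finite_generators : Module.Finite ℚ (⨁ r, W r)
  finite_cohomology : Module.Finite ℚ (⨁ n, M.Cohomology n)

end CDGA

/-! ### The algebra of a finite graph -/

/-- The generators `x₁, x₂, y₁, y₂, y₃, z` and `x_v, z_v` for `v ∈ V`. -/
inductive Gen (V : Type u) : Type u
  | x₁ | x₂ | y₁ | y₂ | y₃ | z
  | xv (v : V)
  | zv (v : V)

namespace Gen

variable {V : Type u}

/-- The degrees of the generators. -/
def deg : Gen V → ℕ
  | x₁ => 8
  | x₂ => 10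
  | y₁ => 33
  | y₂ => 35
  | y₃ => 37
  | z => 119
  | xv _ => 40
  | zv _ => 119

/-- A generator as an element of the free graded commutative algebra. -/
abbrev el (i : Gen V) : FreeCGA (deg (V := V)) := FreeCGA.gen deg i

open Classical in
/-- The differential on the generators. -/
noncomputable def diff [Fintype V] (G : SimpleGraph V) : Gen V → FreeCGA (deg (V := V))
  | x₁ => 0
  | x₂ => 0
  | y₁ => x₁.el ^ 3 * x₂.el
  | y₂ => x₁.el ^ 2 * x₂.el ^ 2
  | y₃ => x₁.el * x₂.el ^ 3
  | z => y₁.el * y₂.el * x₁.el ^ 4 * x₂.el ^ 2 - y₁.el * y₃.el * x₁.el ^ 5 * x₂.el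
      + y₂.el * y₃.el * x₁.el ^ 6 + x₁.el ^ 15 + x₂.el ^ 12
  | xv _ => 0
  | zv v => (xv v).el ^ 3 + ∑ w with G.Adj v w, (xv v).el * (xv w).el * x₂.el ^ 4

theorem mul_mem' {m n k : ℕ} {a b : FreeCGA (deg (V := V))} (ha : a ∈ FreeCGA.gr deg m)
    (hb : b ∈ FreeCGA.gr deg n) (h : m + n = k) : a * b ∈ FreeCGA.gr deg k :=
  h ▸ FreeCGA.mul_mem ha hb

theorem pow_mem' {m k : ℕ} {a : FreeCGA (deg (V := V))} (ha : a ∈ FreeCGA.gr deg m) (n : ℕ)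
    (h : n * m = k) : a ^ n ∈ FreeCGA.gr deg k := by
  have := SetLike.pow_mem_graded n ha
  rwa [smul_eq_mul, h] at this

theorem x₁_mem : (x₁ : Gen V).el ∈ FreeCGA.gr (deg (V := V)) 8 := FreeCGA.gen_mem x₁
theorem x₂_mem : (x₂ : Gen V).el ∈ FreeCGA.gr (deg (V := V)) 10 := FreeCGA.gen_mem x₂
theorem y₁_mem : (y₁ : Gen V).el ∈ FreeCGA.gr (deg (V := V)) 33 := FreeCGA.gen_mem y₁
theorem y₂_mem : (y₂ : Gen V).el ∈ FreeCGA.gr (deg (V := V)) 35 := FreeCGA.gen_mem y₂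
theorem y₃_mem : (y₃ : Gen V).el ∈ FreeCGA.gr (deg (V := V)) 37 := FreeCGA.gen_mem y₃
theorem xv_mem (v : V) : (xv v).el ∈ FreeCGA.gr (deg (V := V)) 40 := FreeCGA.gen_mem (xv v)

theorem diff_mem [Fintype V] (G : SimpleGraph V) (i : Gen V) :
    diff G i ∈ FreeCGA.gr (deg (V := V)) (deg i + 1) := by
  cases i with
  | x₁ => exact zero_mem _
  | x₂ => exact zero_mem _
  | xv v => exact zero_mem _
  | y₁ => exact mul_mem' (pow_mem' x₁_mem 3 rfl) x₂_mem rfl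
  | y₂ => exact mul_mem' (pow_mem' x₁_mem 2 rfl) (pow_mem' x₂_mem 2 rfl) rfl
  | y₃ => exact mul_mem' x₁_mem (pow_mem' x₂_mem 3 rfl) rfl
  | z =>
    refine add_mem (add_mem (add_mem (sub_mem ?_ ?_) ?_) ?_) ?_
    · exact mul_mem' (mul_mem' (mul_mem' y₁_mem y₂_mem rfl) (pow_mem' x₁_mem 4 rfl) rfl)
        (pow_mem' x₂_mem 2 rfl) rfl
    · exact mul_mem' (mul_mem' (mul_mem' y₁_mem y₃_mem rfl) (pow_mem' x₁_mem 5 rfl) rfl)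
        x₂_mem rfl
    · exact mul_mem' (mul_mem' y₂_mem y₃_mem rfl) (pow_mem' x₁_mem 6 rfl) rfl
    · exact pow_mem' x₁_mem 15 rfl
    · exact pow_mem' x₂_mem 12 rfl
  | zv v =>
    refine add_mem (pow_mem' (xv_mem v) 3 rfl) (sum_mem fun w _ => ?_)
    exact mul_mem' (mul_mem' (xv_mem v) (xv_mem w) rfl) (pow_mem' x₂_mem 4 rfl) rfl

theorem diff_z_aux {A : Type*} [Ring A] (a b p q r : A) (hba : b * a = a * b)
    (hpa : p * a = a * p) (hpb : p * b = b * p) (hqa : q * a = a * q) (hqb : q * b = b * q)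
    (hra : r * a = a * r) (hrb : r * b = b * r) :
    (a ^ 3 * b * q - p * (a ^ 2 * b ^ 2)) * (a ^ 4 * b ^ 2)
      - (a ^ 3 * b * r - p * (a * b ^ 3)) * (a ^ 5 * b)
      + (a ^ 2 * b ^ 2 * r - q * (a * b ^ 3)) * a ^ 6 = 0 := by
  have l1 : ∀ t, b * (a * t) = a * (b * t) := fun t => by rw [← mul_assoc, hba, mul_assoc]
  have l2 : ∀ t, p * (a * t) = a * (p * t) := fun t => by rw [← mul_assoc, hpa, mul_assoc]
  have l3 : ∀ t, p * (b * t) = b * (p * t) := fun t => by rw [← mul_assoc, hpb, mul_assoc]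
  have l4 : ∀ t, q * (a * t) = a * (q * t) := fun t => by rw [← mul_assoc, hqa, mul_assoc]
  have l5 : ∀ t, q * (b * t) = b * (q * t) := fun t => by rw [← mul_assoc, hqb, mul_assoc]
  have l6 : ∀ t, r * (a * t) = a * (r * t) := fun t => by rw [← mul_assoc, hra, mul_assoc]
  simp only [pow_succ, pow_zero, one_mul, sub_mul, mul_assoc, hpb, hqa, hqb, hra, hrb,
    l1, l2, l3, l4, l5, l6]
  abel

theorem diff_closed [Fintype V] (G : SimpleGraph V) (i : Gen V) :
    FreeCGA.derivation (diff G) (diff_mem G) (diff G i) = 0 := by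
  set d := FreeCGA.derivation (diff G) (diff_mem G) with hd
  have hmul : ∀ {m : ℕ} {a b : FreeCGA (deg (V := V))}, a ∈ FreeCGA.gr deg m → d a = 0 →
      d b = 0 → d (a * b) = 0 := fun {m a b} h ha hb => by
    rw [hd, FreeCGA.derivation_mul _ _ b h, ← hd, ha, hb]; simp
  have hpow : ∀ {m : ℕ} {a : FreeCGA (deg (V := V))}, a ∈ FreeCGA.gr deg m → d a = 0 →
      ∀ n, d (a ^ n) = 0 := fun {m a} h ha n => by
    induction n with
    | zero => simp [hd]
    | succ n ih => rw [pow_succ']; exact hmul h ha ih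
  have hg : ∀ j : Gen V, d j.el = diff G j := FreeCGA.derivation_gen _ _
  have h1 : d x₁.el = 0 := hg x₁
  have h2 : d x₂.el = 0 := hg x₂
  have hv : ∀ v, d (xv v).el = 0 := fun v => hg (xv v)
  cases i with
  | x₁ => exact map_zero d
  | x₂ => exact map_zero d
  | xv v => exact map_zero d
  | y₁ => exact hmul (pow_mem' x₁_mem 3 rfl) (hpow x₁_mem h1 3) h2
  | y₂ => exact hmul (pow_mem' x₁_mem 2 rfl) (hpow x₁_mem h1 2) (hpow x₂_mem h2 2)
  | y₃ => exact hmul x₁_mem h1 (hpow x₂_mem h2 3)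
  | z =>
    have e : ∀ {m n : ℕ} {a b : FreeCGA (deg (V := V))}, a ∈ FreeCGA.gr deg m →
        b ∈ FreeCGA.gr deg n → Odd m → ∀ {p}, d p = 0 →
        d (a * b * p) = (d a * b - a * d b) * p := fun {m n a b} ha hb hm {p} hp => by
      rw [hd, FreeCGA.derivation_mul _ _ p (FreeCGA.mul_mem ha hb), FreeCGA.derivation_mul _ _ b ha,
        ← hd, hp, hm.neg_one_pow]
      simp [sub_eq_add_neg]
    have c : ∀ {m n : ℕ} {a b : FreeCGA (deg (V := V))}, a ∈ FreeCGA.gr deg m →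
        b ∈ FreeCGA.gr deg n → Even n → a * b = b * a := fun {m n a b} ha hb hn => by
      rw [FreeCGA.comm ha hb, (hn.mul_left m).neg_one_pow, one_mul]
    have hy1 : d y₁.el = x₁.el ^ 3 * x₂.el := hg y₁
    have hy2 : d y₂.el = x₁.el ^ 2 * x₂.el ^ 2 := hg y₂
    have hy3 : d y₃.el = x₁.el * x₂.el ^ 3 := hg y₃
    have o1 : Odd 33 := by decide
    have o2 : Odd 35 := by decide
    have e8 : Even 8 := by decide
    have e10 : Even 10 := by decide
    change d (y₁.el * y₂.el * x₁.el ^ 4 * x₂.el ^ 2 - y₁.el * y₃.el * x₁.el ^ 5 * x₂.el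
      + y₂.el * y₃.el * x₁.el ^ 6 + x₁.el ^ 15 + x₂.el ^ 12) = 0
    rw [map_add, map_add, hpow x₁_mem h1, hpow x₂_mem h2, add_zero, add_zero, map_add, map_sub,
      mul_assoc (y₁.el * y₂.el), mul_assoc (y₁.el * y₃.el),
      e y₁_mem y₂_mem o1 (hmul (pow_mem' x₁_mem 4 rfl) (hpow x₁_mem h1 4) (hpow x₂_mem h2 2)),
      e y₁_mem y₃_mem o1 (hmul (pow_mem' x₁_mem 5 rfl) (hpow x₁_mem h1 5) h2),
      e y₂_mem y₃_mem o2 (hpow x₁_mem h1 6), hy1, hy2, hy3]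
    exact diff_z_aux _ _ _ _ _ (c x₂_mem x₁_mem e8) (c y₁_mem x₁_mem e8) (c y₁_mem x₂_mem e10)
      (c y₂_mem x₁_mem e8) (c y₂_mem x₂_mem e10) (c y₃_mem x₁_mem e8) (c y₃_mem x₂_mem e10)
  | zv v =>
    simp only [diff, map_add, map_sum]
    rw [hpow (xv_mem v) (hv v), zero_add]
    refine Finset.sum_eq_zero fun w _ => ?_
    exact hmul (FreeCGA.mul_mem (xv_mem v) (xv_mem w)) (hmul (xv_mem v) (hv v) (hv w))
      (hpow x₂_mem h2 4)

end Gen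

/-- The algebra `M_G = (Λ(x₁, x₂, y₁, y₂, y₃, z) ⊗ Λ(x_v, z_v | v ∈ V), d)` of a finite
graph `G` with vertex set `V`. -/
noncomputable def graphAlgebra {V : Type u} [Fintype V] (G : SimpleGraph V) : CDGA.{u} :=
  FreeCGA.toCDGA (Gen.diff G) (Gen.diff_mem G) (Gen.diff_closed G)

/-- The graded space `W` spanned by the generators of `M_G`. -/
noncomputable def graphGenerators {V : Type u} [Fintype V] (G : SimpleGraph V) (r : ℕ) :
    Submodule ℚ (graphAlgebra G) :=
  Submodule.span ℚ {a : FreeCGA (Gen.deg (V := V)) | ∃ i : Gen V, i.deg = r ∧ i.el = a}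

end RatHom

/-! The algebra is minimal and Sullivan by inspection of `d` on generators. The substance is
Poincaré duality, which holds for every free algebra ΛW on finitely many generators of degree at
least 2 whose even generators are closed and nilpotent in cohomology (`FreeCGA.hasFormalDimension`).

Write x_i^{K_i} = d w_i for each even generator x_i. Modulo all the powers x_i^{K_i}, ΛW becomes a
truncated polynomial algebra tensor an exterior algebra. This is a finite-dimensional Frobenius
algebra whose functional ε, the coefficient of the top monomial, kills coboundaries. A Frobenius
functional that kills coboundaries induces a duality on cohomology (`IsDualizing.of_frobenius`). The
powers are then removed from the ideal one at a time: each is regular modulo the others, and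
replacing ε by ε(w_i · ) preserves duality (`IsDualizing.descend`), a chain-level form of the
connecting map of a regular element. At the end the ideal is zero and duality holds on H(ΛW) itself.
Each w_i lowers the degree of ε by K_i deg x_i - 1, so the formal dimension is the sum of the odd
degrees minus the sum of deg x_i - 1 over the even generators. The K_i cancel.

It remains to see that the even generators of M_G are nilpotent in cohomology. Let q be the part of
dz involving the y_i. Then x₂ q = x₁³ d(y₁y₂y₃), so x₂ dz shows that x₂¹³ is exact. Next, x₁¹⁶ + x₁
q is exact, with q closed and q² = 0; multiplying by x₁¹⁶ - x₁ q shows that x₁³² is exact. Finally d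
z_v gives x_v³ ≡ -x₂⁴ p modulo exact elements, and the fourth power of the right side contains x₂¹³,
so x_v¹² is exact. -/

namespace RatHom

open scoped DirectSum

/-! ### Dualizing functionals -/

/-- A linear functional `ε` on the differential algebra `(A, d)` is dualizing modulo `I` if it
vanishes on `I` and on coboundaries, and if a cocycle modulo `I` which pairs to zero with all
cocycles modulo `I` is a coboundary modulo `I`. -/
structure IsDualizing {A : Type*} [Ring A] [Algebra ℚ A] (d : A →ₗ[ℚ] A) (I : Submodule ℚ A)
    (ε : A →ₗ[ℚ] ℚ) : Prop where
  vanish : ∀ a ∈ I, ε a = 0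
  closed : ∀ a, ε (d a) = 0
  perfect : ∀ a, d a ∈ I → (∀ b, d b ∈ I → ε (a * b) = 0) → ∃ b, a - d b ∈ I

namespace IsDualizing

variable {A : Type*} [Ring A] [Algebra ℚ A] {d : A →ₗ[ℚ] A}

/-- Removing from the ideal `I'` a generator `c = d w` which is regular modulo `I`. -/
theorem descend {I I' : Submodule ℚ A} {ε : A →ₗ[ℚ] ℚ} (c w : A) (hε : IsDualizing d I' ε)
    (hdd : ∀ a, d (d a) = 0) (hI' : ∀ a, a ∈ I' ↔ ∃ e ∈ I, ∃ m, a = e + c * m)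
    (hw : ∀ b, d (w * b) = c * b - w * d b) (hc : ∀ m, d (c * m) = c * d m)
    (hreg : ∀ m, c * m ∈ I → m ∈ I) (hdI : ∀ a ∈ I, d a ∈ I) (hwI : ∀ a ∈ I, w * a ∈ I)
    (hwaw : ∀ a, w * a * w = 0) :
    IsDualizing d I (ε ∘ₗ LinearMap.mulLeft ℚ w) where
  vanish a ha := hε.vanish _ ((hI' _).2 ⟨_, hwI a ha, 0, by simp⟩)
  closed a := by
    have h : w * d a = c * a - d (w * a) := by rw [hw]; abel
    simp only [LinearMap.comp_apply, LinearMap.mulLeft_apply]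
    rw [h, map_sub, hε.closed, hε.vanish _ ((hI' _).2 ⟨0, zero_mem _, a, by simp⟩), sub_zero]
  perfect a ha hab := by
    -- Duality modulo `I'` is applied to `w * a`, a cocycle modulo `I'` since `d (w * a) = c * a - w
    -- * d a`.
    have hcl : d (w * a) ∈ I' := (hI' _).2 ⟨-(w * d a), neg_mem (hwI _ ha), a, by rw [hw]; abel⟩
    obtain ⟨b, hb⟩ := hε.perfect (w * a) hcl fun b' hb' => by
      obtain ⟨e, he, m, hm⟩ := (hI' _).1 hb'
      -- Differentiating `d b' = e + c * m` gives `c * d m ∈ I`, and `c` is regular modulo `I`.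
      have hdm : d m ∈ I := hreg _ <| by
        have h := hdd b'
        rw [hm, map_add, hc] at h
        rw [← neg_eq_of_add_eq_zero_right h]
        exact neg_mem (hdI e he)
      -- A cocycle `b'` modulo `I'` is corrected to a cocycle modulo `I`. The correction is
      -- invisible to the pairing because `w * a * w = 0`.
      have hs := hab (b' - w * m) <| by
        rw [map_sub, hm, hw]
        have : e + c * m - (c * m - w * d m) = e + w * d m := by abel
        rw [this]
        exact add_mem he (hwI _ hdm)
      simp only [LinearMap.comp_apply, LinearMap.mulLeft_apply] at hs
      have h : w * (a * (b' - w * m)) = w * a * b' := by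
        rw [mul_sub, mul_sub, ← mul_assoc, ← mul_assoc a w m, ← mul_assoc w, ← mul_assoc w, hwaw,
          zero_mul, sub_zero]
      rwa [h] at hs
    obtain ⟨e, he, m, hm⟩ := (hI' _).1 hb
    -- Differentiating `w * a - d b = e + c * m` gives `c * (a - d m) = d e + w * d a`, which lies
    -- in `I`; cancelling `c` shows that `m` is the primitive sought.
    refine ⟨m, hreg _ ?_⟩
    have h := congrArg d hm
    rw [map_sub, hdd, sub_zero, hw, map_add, hc] at h
    have h2 : c * (a - d m) = d e + w * d a := by
      rw [mul_sub, sub_eq_iff_eq_add, add_right_comm, ← h]; abel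
    rw [h2]
    exact add_mem (hdI e he) (hwI _ ha)

/-- A functional which makes `A / I` a Frobenius algebra is dualizing modulo `I`. -/
theorem of_frobenius {I : Submodule ℚ A} {ε : A →ₗ[ℚ] ℚ} (hI : ∀ a ∈ I, ε a = 0)
    (hd : ∀ a, ε (d a) = 0) (hleib : ∀ h, ∃ h', ∀ b, d (h' * b) = d h' * b + h * d b)
    (hrep : ∀ g : A →ₗ[ℚ] ℚ, (∀ a ∈ I, g a = 0) → ∃ h, ∀ m, g m = ε (h * m))
    (hnd : ∀ a, (∀ b, ε (a * b) = 0) → a ∈ I) : IsDualizing d I ε where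
  vanish := hI
  closed := hd
  perfect a _ hab := by
    -- The functional `ε (a * ·)` kills all cocycles modulo `I`, so it factors through `d` followed
    -- by the quotient map.
    set f : A →ₗ[ℚ] ℚ := ε ∘ₗ LinearMap.mulLeft ℚ a with hf
    have hmem : f ∈ (LinearMap.ker (I.mkQ ∘ₗ d)).dualAnnihilator := by
      rw [Submodule.mem_dualAnnihilator]
      intro b hb
      exact hab b (by simpa using hb)
    rw [← LinearMap.range_dualMap_eq_dualAnnihilator_ker] at hmem
    obtain ⟨g, hg⟩ := hmem
    obtain ⟨h, hh⟩ := hrep (g ∘ₗ I.mkQ) fun a ha => by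
      rw [LinearMap.comp_apply, Submodule.mkQ_apply, (Submodule.Quotient.mk_eq_zero I).2 ha,
        map_zero]
    obtain ⟨h', hh'⟩ := hleib h
    -- Integration by parts: `ε (a * b) = ε (h * d b) = -ε (d h' * b)`, so nondegeneracy puts `a + d
    -- h'` in `I`.
    refine ⟨-h', hnd _ fun b => ?_⟩
    have h1 : f b = ε (h * d b) := by
      rw [← hh, ← hg]; rfl
    have h2 : h * d b = d (h' * b) - d h' * b := by rw [hh']; abel
    rw [h2, map_sub, hd, zero_sub] at h1
    rw [map_neg, sub_neg_eq_add, add_mul, map_add, ← neg_eq_iff_add_eq_zero.1 h1.symm]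
    exact add_comm _ _

end IsDualizing

/-! ### Poincaré duality from a dualizing functional -/

namespace CDGA

variable (M : CDGA.{u})

/-- Homogeneous projections as plain linear maps, so that later arguments avoid the direct sum. The
span clause stands in for writing an element as the sum of its components. -/
theorem exists_components : ∃ π : ℕ → M →ₗ[ℚ] M, (∀ n a, π n a ∈ M.gr n) ∧
    (∀ n, ∀ a ∈ M.gr n, π n a = a) ∧ (∀ n m, ∀ a ∈ M.gr n, n ≠ m → π m a = 0) ∧
    (∀ n a, π (n + 1) (M.d a) = M.d (π n a)) ∧ ∀ a, a ∈ Submodule.span ℚ {b | ∃ n, π n a = b} := by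
  classical
  let _ := M.isInternal.chooseDecomposition
  refine ⟨fun n => (M.gr n).subtype ∘ₗ DirectSum.component ℚ ℕ (fun n => M.gr n) n ∘ₗ
    (DirectSum.decomposeLinearEquiv M.gr).toLinearMap, ?_, ?_, ?_, ?_, ?_⟩
  · intro n a
    exact Subtype.coe_prop _
  · intro n a ha
    exact DirectSum.decompose_of_mem_same M.gr ha
  · intro n m a ha h
    exact DirectSum.decompose_of_mem_ne M.gr ha h
  · intro n a
    change (DirectSum.decompose M.gr (M.d a) (n + 1) : M) = M.d (DirectSum.decompose M.gr a n)
    induction a using DirectSum.Decomposition.inductionOn M.gr with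
    | zero => simp
    | @homogeneous i m =>
      by_cases h : i = n
      · subst h
        rw [DirectSum.decompose_of_mem_same M.gr m.2,
          DirectSum.decompose_of_mem_same M.gr (M.d_mem m.2)]
      · rw [DirectSum.decompose_of_mem_ne M.gr m.2 h,
          DirectSum.decompose_of_mem_ne M.gr (M.d_mem m.2) (by omega), map_zero]
    | add a b ha hb => simp [DirectSum.decompose_add, DirectSum.add_apply, ha, hb]
  · intro a
    have h := DirectSum.sum_support_decompose M.gr a
    exact (congrArg (· ∈ Submodule.span ℚ _) h).mp
      (sum_mem fun i _ => Submodule.subset_span ⟨i, rfl⟩)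

variable {M}

/-- A functional vanishing on homogeneous cocycles vanishes on all cocycles. -/
theorem eq_zero_of_homogeneous {L : M →ₗ[ℚ] ℚ} (hL : ∀ n, ∀ b ∈ M.cocycles n, L b = 0) {b : M}
    (hb : M.d b = 0) : L b = 0 := by
  obtain ⟨π, h1, -, -, h4, h5⟩ := M.exists_components
  have h : Submodule.span ℚ {c | ∃ n, π n b = c} ≤ LinearMap.ker L := by
    rw [Submodule.span_le]
    rintro _ ⟨n, rfl⟩
    have hd : M.d (π n b) = 0 := by rw [← h4, hb, map_zero]
    exact hL n _ ⟨h1 n b, hd⟩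
  exact h (h5 b)

theorem exists_homogeneous_primitive {n : ℕ} {a b : M} (ha : a ∈ M.gr (n + 1)) (hb : M.d b = a) :
    ∃ c ∈ M.gr n, M.d c = a := by
  obtain ⟨π, h1, h2, -, h4, -⟩ := M.exists_components
  exact ⟨π n b, h1 n b, by rw [← h4, hb, h2 _ _ ha]⟩

/-- The differential raises degree and degrees start at 0, so a coboundary has no component in
degree 0. -/
theorem eq_zero_of_mem_gr_zero {a b : M} (ha : a ∈ M.gr 0) (hb : M.d b = a) : a = 0 := by
  obtain ⟨π, h1, h2, h3, h4, h5⟩ := M.exists_components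
  have h : Submodule.span ℚ {c | ∃ n, π n b = c} ≤ LinearMap.ker (π 0 ∘ₗ M.d) := by
    rw [Submodule.span_le]
    rintro _ ⟨n, rfl⟩
    exact h3 (n + 1) 0 _ (M.d_mem (h1 n b)) (by omega)
  have := h (h5 b)
  rwa [LinearMap.mem_ker, LinearMap.comp_apply, hb, h2 0 a ha] at this

theorem mk_eq_zero_iff {n : ℕ} (a : M.cocycles n) :
    (Submodule.Quotient.mk a : M.Cohomology n) = 0 ↔ ∃ b, M.d b = a := by
  rw [Submodule.Quotient.mk_eq_zero]
  exact ⟨fun h => h.2, fun h => ⟨a.2.1, h⟩⟩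

/-- Since ε lives in degree `n`, a homogeneous cocycle need only be tested against cocycles of
complementary degree (`key`). Above degree `n` there are none, so cohomology vanishes; in degree `n`
the tests are scalars, so ε is injective on H^n. -/
theorem hasFormalDimension_of_isDualizing {n : ℕ} {ε : M →ₗ[ℚ] ℚ} (hε : IsDualizing M.d ⊥ ε)
    (hn : ∀ i, ∀ a ∈ M.gr i, i ≠ n → ε a = 0) (hfin : ∀ i, Module.Finite ℚ (M.gr i))
    (hone : (1 : M) ≠ 0) (hzero : ∀ a ∈ M.gr 0, ∃ q : ℚ, a = q • (1 : M)) :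
    M.HasFormalDimension n := by
  have hd1 : M.d 1 = 0 := by
    have := M.leibniz 1 M.one_mem
    simpa using this
  have key : ∀ i, ∀ a ∈ M.cocycles i,
      (∀ j, i + j = n → ∀ b ∈ M.cocycles j, ε (a * b) = 0) → ∃ b, M.d b = a := by
    intro i a ha hab
    obtain ⟨b, hb⟩ := hε.perfect a (by simpa using ha.2) fun b hb =>
      eq_zero_of_homogeneous (L := ε ∘ₗ LinearMap.mulLeft ℚ a) (fun j b hb => by
        by_cases h : i + j = n
        · exact hab j h b hb
        · exact hn _ _ (M.mul_mem ha.1 hb.1) h) (by simpa using hb)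
    exact ⟨b, (sub_eq_zero.1 (by simpa using hb)).symm⟩
  have hcob : ∀ a b, M.d b = a → ε a = 0 := fun a b h => h ▸ hε.closed b
  have hleft : ∀ i j, i + j = n → ∀ a : M.Cohomology i, a ≠ 0 →
      ∃ b : M.Cohomology j, M.cup i j a b ≠ 0 := by
    intro i j hij a ha
    obtain ⟨a, rfl⟩ := Submodule.Quotient.mk_surjective _ a
    by_contra! hcon
    refine ha ((mk_eq_zero_iff a).2 (key i a a.2 fun j' hj' b hb => ?_))
    obtain rfl : j' = j := by omega
    have h := hcon (Submodule.Quotient.mk ⟨b, hb⟩)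
    rw [cup_mk] at h
    obtain ⟨c, hc⟩ := (mk_eq_zero_iff _).1 h
    exact hcob _ c hc
  have hker : ∀ a : M.cocycles n, ε a = 0 → (Submodule.Quotient.mk a : M.Cohomology n) = 0 := by
    intro a ha
    refine (mk_eq_zero_iff a).2 (key n a a.2 fun j hj b hb => ?_)
    obtain rfl : j = 0 := by omega
    obtain ⟨q, rfl⟩ := hzero b hb.1
    simp [ha]
  have hfinH : ∀ i, Module.Finite ℚ (M.Cohomology i) := fun i => by
    have := hfin i
    have : Module.Finite ℚ (M.cocycles i) :=
      Module.Finite.of_injective (Submodule.inclusion (inf_le_left : M.cocycles i ≤ M.gr i))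
        (Submodule.inclusion_injective _)
    infer_instance
  refine ⟨hfinH, ?_, ?_, hleft, ?_⟩
  · intro i hi
    refine subsingleton_of_forall_eq 0 fun a => ?_
    obtain ⟨a, rfl⟩ := Submodule.Quotient.mk_surjective _ a
    exact (mk_eq_zero_iff a).2 (key i a a.2 fun j hj => by omega)
  -- If ε vanished on H^n, then 1 would pair to zero with every cocycle and be a coboundary.
  · have hex : ∃ a : M.cocycles n, ε a ≠ 0 := by
      by_contra! hcon
      obtain ⟨b, hb⟩ := key 0 1 ⟨M.one_mem, hd1⟩ fun j hj b hb => by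
        obtain rfl : j = n := by omega
        rw [one_mul]; exact hcon ⟨b, hb⟩
      exact hone (eq_zero_of_mem_gr_zero M.one_mem hb)
    obtain ⟨a, ha⟩ := hex
    refine finrank_eq_one (Submodule.Quotient.mk a) (fun h => ?_) fun b => ?_
    · obtain ⟨c, hc⟩ := (mk_eq_zero_iff a).1 h
      exact ha (hcob _ c hc)
    · obtain ⟨b, rfl⟩ := Submodule.Quotient.mk_surjective _ b
      refine ⟨ε b / ε a, ?_⟩
      rw [← sub_eq_zero, ← Submodule.Quotient.mk_smul, ← Submodule.Quotient.mk_sub]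
      refine hker _ ?_
      simp [div_mul_cancel₀ _ ha]
  · intro i j hij b hb
    obtain ⟨a, ha⟩ := hleft j i (by omega) b hb
    refine ⟨a, fun h => ha ?_⟩
    obtain ⟨b, rfl⟩ := Submodule.Quotient.mk_surjective _ b
    obtain ⟨a, rfl⟩ := Submodule.Quotient.mk_surjective _ a
    rw [cup_mk, mk_eq_zero_iff] at h ⊢
    obtain ⟨c, hc⟩ := h
    rcases neg_one_pow_eq_or M (j * i) with hs | hs
    · exact ⟨c, by rw [hc]; simp [M.comm b.2.1 a.2.1, hs]⟩
    · exact ⟨-c, by rw [map_neg, hc]; simp [M.comm b.2.1 a.2.1, hs]⟩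

end CDGA

/-! ### The coefficient of the product of all odd generators -/

namespace FreeCGA

variable {ι : Type u} {deg : ι → ℕ}

theorem mono_perm {l l' : List ι} (h : l.Perm l') :
    mono deg l = mono deg l' ∨ mono deg l = -mono deg l' := by
  induction h with
  | nil => simp
  | cons i _ ih => rcases ih with ih | ih <;> simp [ih]
  | swap i j l =>
    simp only [mono_cons, ← mul_assoc]
    rw [gen_mul_gen j i]
    rcases neg_one_pow_eq_or (FreeCGA deg) (deg j * deg i) with h | h <;> simp [h]
  | trans _ _ h1 h2 => rcases h1 with h1 | h1 <;> rcases h2 with h2 | h2 <;> simp [h1, h2]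

theorem gen_mul_self {i : ι} (hi : ¬ Even (deg i)) : gen deg i * gen deg i = 0 := by
  have h := gen_mul_gen (deg := deg) i i
  rw [sign_odd ((Nat.not_even_iff_odd.1 hi).mul (Nat.not_even_iff_odd.1 hi))] at h
  have h2 : (2 : ℚ) • (gen deg i * gen deg i) = 0 := by
    rw [two_smul]; exact eq_neg_iff_add_eq_zero.1 h
  exact (smul_eq_zero_iff_right two_ne_zero).1 h2

theorem gen_mul_comm {i : ι} (hi : Even (deg i)) (a : FreeCGA deg) :
    gen deg i * a = a * gen deg i := by
  induction a using induction_mono with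
  | h l => rw [gen_mul_mono, sign_even (hi.mul_right _)]
  | h0 => simp
  | ha a b h1 h2 => rw [mul_add, add_mul, h1, h2]
  | hs r a h => rw [mul_smul_comm, smul_mul_assoc, h]

/-! ### Even generators as a central polynomial algebra -/

variable (deg) in
/-- The generators of even degree. -/
abbrev EvenGen := {i : ι // Even (deg i)}

variable (deg) in
/-- The generators of odd degree. -/
abbrev OddGen := {i : ι // ¬ Even (deg i)}

variable (deg) in
/-- The polynomial algebra on the generators of even degree. -/
abbrev EvenPoly := MvPolynomial (EvenGen deg) ℚ

/-- The inclusion of the polynomials in the even generators. -/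
noncomputable def ev : EvenPoly deg →ₐ[ℚ] FreeCGA deg :=
  (Subalgebra.center ℚ (FreeCGA deg)).val.comp (MvPolynomial.aeval fun i : EvenGen deg =>
    ⟨gen deg i, Subalgebra.mem_center_iff.2 fun a => (gen_mul_comm i.2 a).symm⟩)

@[simp] theorem ev_X (i : EvenGen deg) : ev (MvPolynomial.X i) = gen deg (i : ι) := by
  simp [ev]

theorem ev_comm (p : EvenPoly deg) (a : FreeCGA deg) : a * ev p = ev p * a :=
  Subalgebra.mem_center_iff.1 (Subtype.coe_prop (MvPolynomial.aeval (fun i : EvenGen deg =>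
    (⟨gen deg i, Subalgebra.mem_center_iff.2 fun a => (gen_mul_comm i.2 a).symm⟩ :
      Subalgebra.center ℚ (FreeCGA deg))) p)) a

theorem mul_ev_mul (a : FreeCGA deg) (p : EvenPoly deg) (b : FreeCGA deg) :
    a * (ev p * b) = ev p * (a * b) := by
  rw [← mul_assoc, ev_comm, mul_assoc]

/-- The product of a list of odd generators. -/
def oddMono (L : List (OddGen deg)) : FreeCGA deg := mono deg (L.map Subtype.val)

theorem oddMono_append (L L' : List (OddGen deg)) :
    oddMono (L ++ L') = oddMono L * oddMono L' := by
  rw [oddMono, List.map_append, mono_append]; rfl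

theorem oddMono_perm {L L' : List (OddGen deg)} (h : L.Perm L') :
    oddMono L = oddMono L' ∨ oddMono L = -oddMono L' :=
  mono_perm (h.map _)

theorem oddMono_eq_zero {L : List (OddGen deg)} (h : ¬ L.Nodup) : oddMono L = 0 := by
  obtain ⟨i, hi⟩ := List.exists_duplicate_iff_not_nodup.2 h
  obtain ⟨L', hL'⟩ := (List.duplicate_iff_sublist.1 hi).exists_perm_append
  have h0 : oddMono ([i, i] ++ L') = 0 := by
    simp [oddMono, ← mul_assoc, gen_mul_self i.2]
  rcases oddMono_perm hL' with h | h <;> rw [h, h0]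
  exact neg_zero

/-- Even generators are central, so they can be collected in front of the odd ones. The weight `k`
is recorded for the later degree counts. -/
theorem exists_mono_eq (l : List ι) : ∃ (p : EvenPoly deg) (L : List (OddGen deg)) (k : ℕ),
    mono deg l = ev p * oddMono L ∧ wt deg l = k + wt deg (L.map Subtype.val) ∧
      p.IsWeightedHomogeneous (fun i : EvenGen deg => deg i) k := by
  induction l with
  | nil => exact ⟨1, [], 0, by simp [oddMono], by simp, MvPolynomial.isWeightedHomogeneous_one _ _⟩
  | cons i l ih =>
    obtain ⟨p, L, k, h1, h2, h3⟩ := ih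
    by_cases hi : Even (deg i)
    · refine ⟨MvPolynomial.X ⟨i, hi⟩ * p, L, deg i + k, ?_, ?_, ?_⟩
      · rw [mono_cons, h1, map_mul, ev_X, mul_assoc]
      · rw [wt_cons, h2, add_assoc]
      · exact (MvPolynomial.isWeightedHomogeneous_X ℚ (fun i : EvenGen deg => deg i) ⟨i, hi⟩).mul h3
    · refine ⟨p, ⟨i, hi⟩ :: L, k, ?_, ?_, h3⟩
      · rw [mono_cons, h1, mul_ev_mul]; rfl
      · rw [wt_cons, h2, List.map_cons, wt_cons]; ring

/-! ### Comparison with an exterior algebra, as a source of linear functionals -/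

variable (deg) in
/-- The exterior algebra over the polynomials in the even generators, on the odd generators. -/
abbrev Ext := ExteriorAlgebra (EvenPoly deg) (OddGen deg → EvenPoly deg)

open Classical in
theorem toExt_rel (i j : ι) :
    (if h : Even (deg i) then algebraMap (EvenPoly deg) (Ext deg) (MvPolynomial.X ⟨i, h⟩)
      else ExteriorAlgebra.ι (EvenPoly deg) (Pi.single ⟨i, h⟩ 1)) *
    (if h : Even (deg j) then algebraMap (EvenPoly deg) (Ext deg) (MvPolynomial.X ⟨j, h⟩)
      else ExteriorAlgebra.ι (EvenPoly deg) (Pi.single ⟨j, h⟩ 1)) = (-1) ^ (deg i * deg j) *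
    ((if h : Even (deg j) then algebraMap (EvenPoly deg) (Ext deg) (MvPolynomial.X ⟨j, h⟩)
      else ExteriorAlgebra.ι (EvenPoly deg) (Pi.single ⟨j, h⟩ 1)) *
    (if h : Even (deg i) then algebraMap (EvenPoly deg) (Ext deg) (MvPolynomial.X ⟨i, h⟩)
      else ExteriorAlgebra.ι (EvenPoly deg) (Pi.single ⟨i, h⟩ 1))) := by
  by_cases hi : Even (deg i)
  · rw [sign_even (hi.mul_right _), dif_pos hi]
    exact Algebra.commutes _ _
  · by_cases hj : Even (deg j)
    · rw [sign_even (hj.mul_left _), dif_pos hj]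
      exact (Algebra.commutes _ _).symm
    · rw [sign_odd ((Nat.not_even_iff_odd.1 hi).mul (Nat.not_even_iff_odd.1 hj)), dif_neg hi,
        dif_neg hj]
      exact eq_neg_of_add_eq_zero_left (ExteriorAlgebra.ι_add_mul_swap _ _)

open Classical in
/-- The comparison with the exterior algebra over the polynomials in the even generators. -/
noncomputable def toExt : FreeCGA deg →ₐ[ℚ] Ext deg := lift _ toExt_rel

open Classical in
theorem toExt_oddMono_ofFn {k : ℕ} (f : Fin k → OddGen deg) :
    toExt (oddMono (List.ofFn f)) =
      ExteriorAlgebra.ιMulti (EvenPoly deg) k (fun i => Pi.single (f i) 1) := by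
  rw [ExteriorAlgebra.ιMulti_apply, oddMono, mono, map_list_prod, List.map_ofFn, List.map_ofFn,
    List.map_ofFn]
  congr 2
  funext i
  simp only [Function.comp_apply, toExt, lift_gen]
  rw [dif_neg (f i).2]

theorem toExt_ev (p : EvenPoly deg) : toExt (ev p) = algebraMap (EvenPoly deg) (Ext deg) p := by
  have h : toExt.comp ev = IsScalarTower.toAlgHom ℚ (EvenPoly deg) (Ext deg) := by
    refine MvPolynomial.algHom_ext fun i => ?_
    simp only [AlgHom.comp_apply, ev_X, toExt, lift_gen]
    rw [dif_pos i.2]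
    rfl
  exact DFunLike.congr_fun h p

/-- Closed even generators make the differential linear over the even polynomials. -/
theorem derivation_ev_mul (D : ι → FreeCGA deg) (hD : ∀ i, D i ∈ gr deg (deg i + 1))
    (hD0 : ∀ i, Even (deg i) → D i = 0) (p : EvenPoly deg) (a : FreeCGA deg) : derivation D hD (ev p * a) = ev p * derivation D hD a := by
  induction p using MvPolynomial.induction_on generalizing a with
  | C r =>
    have h : ev (MvPolynomial.C r : EvenPoly deg) = algebraMap ℚ (FreeCGA deg) r :=
      AlgHom.commutes ev r
    rw [h, ← Algebra.smul_def, ← Algebra.smul_def, map_smul]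
  | add p q hp hq => rw [map_add, add_mul, add_mul, map_add, hp, hq]
  | mul_X p i hp =>
    rw [map_mul ev, mul_assoc, mul_assoc, hp, ev_X, derivation_mul D hD _ (gen_mem (i : ι)),
      derivation_gen, hD0 _ i.2, zero_mul, zero_add, sign_even i.2]

/-! ### The top coefficient and its dual bases -/

variable [Fintype ι]

open Classical in
variable (deg) in
/-- The determinant of a family of as many vectors as there are odd generators. -/
noncomputable def volumeForm :
    (OddGen deg → EvenPoly deg) [⋀^Fin (Fintype.card (OddGen deg))]→ₗ[EvenPoly deg] EvenPoly deg :=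
  (Pi.basisFun (EvenPoly deg) (OddGen deg)).det.domDomCongr (Fintype.equivFin (OddGen deg))

/-- The coefficient, a polynomial in the even generators, of the product of all odd
generators. -/
noncomputable def topCoeff : FreeCGA deg →ₗ[ℚ] EvenPoly deg :=
  (ExteriorAlgebra.liftAlternating (R := EvenPoly deg)
    (Pi.single (Fintype.card (OddGen deg)) (volumeForm deg))).restrictScalars ℚ ∘ₗ toExt.toLinearMap

theorem topCoeff_ev_mul (p : EvenPoly deg) (a : FreeCGA deg) :
    topCoeff (ev p * a) = p * topCoeff a := by
  simp only [topCoeff, LinearMap.comp_apply, AlgHom.toLinearMap_apply, map_mul, toExt_ev,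
    LinearMap.restrictScalars_apply]
  rw [← Algebra.smul_def, map_smul, smul_eq_mul]

theorem topCoeff_oddMono_of_length_ne {L : List (OddGen deg)}
    (h : L.length ≠ Fintype.card (OddGen deg)) : topCoeff (oddMono L) = 0 := by
  classical
  rw [topCoeff, LinearMap.comp_apply, AlgHom.toLinearMap_apply, ← List.ofFn_get L,
    toExt_oddMono_ofFn, LinearMap.restrictScalars_apply,
    ExteriorAlgebra.liftAlternating_apply_ιMulti, Pi.single_eq_of_ne h]
  rfl

/-- The value is a sign depending on the order of `L`. Stating that it squares to 1 avoids computing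
it. -/
theorem topCoeff_oddMono_full {L : List (OddGen deg)} (hL : L.Nodup)
    (h : L.length = Fintype.card (OddGen deg)) :
    topCoeff (oddMono L) * topCoeff (oddMono L) = 1 := by
  classical
  have h1 : topCoeff (oddMono (List.ofFn (Fintype.equivFin (OddGen deg)).symm)) = 1 := by
    rw [topCoeff, LinearMap.comp_apply, AlgHom.toLinearMap_apply,
      toExt_oddMono_ofFn, LinearMap.restrictScalars_apply,
      ExteriorAlgebra.liftAlternating_apply_ιMulti, Pi.single_eq_same, volumeForm,
      AlternatingMap.domDomCongr_apply]
    refine Eq.trans (congrArg _ ?_) (Pi.basisFun (EvenPoly deg) (OddGen deg)).det_self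
    funext i
    simp
  have hp : L.Perm (List.ofFn (Fintype.equivFin (OddGen deg)).symm) := by
    refine List.perm_of_nodup_nodup_toFinset_eq hL
      (List.nodup_ofFn.2 (Fintype.equivFin (OddGen deg)).symm.injective) ?_
    have e1 : L.toFinset = Finset.univ :=
      Finset.eq_univ_of_card _ (by rw [List.toFinset_card_of_nodup hL, h])
    rw [e1, eq_comm, Finset.eq_univ_iff_forall]
    intro i
    rw [List.mem_toFinset, List.mem_ofFn]
    exact (Fintype.equivFin (OddGen deg)).symm.surjective i
  rcases oddMono_perm hp with h | h
  · rw [h, h1, mul_one]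
  · rw [h, map_neg, h1, neg_mul_neg, mul_one]

/-- The product of the odd generators in `S`, in some order. -/
noncomputable def oddProd (S : Finset (OddGen deg)) : FreeCGA deg := oddMono S.toList

theorem exists_expansion (a : FreeCGA deg) :
    ∃ p : Finset (OddGen deg) → EvenPoly deg, a = ∑ S, ev (p S) * oddProd S := by
  classical
  induction a using induction_mono with
  | h l =>
    obtain ⟨p, L, -, h, -, -⟩ := exists_mono_eq (deg := deg) l
    rw [h]
    by_cases hL : L.Nodup
    · have hp : L.Perm L.toFinset.toList := by
        refine List.perm_of_nodup_nodup_toFinset_eq hL (Finset.nodup_toList _) ?_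
        simp
      rcases oddMono_perm hp with h | h
      · refine ⟨Pi.single L.toFinset p, ?_⟩
        rw [Finset.sum_eq_single L.toFinset, Pi.single_eq_same, h, oddProd]
        · intro S _ hS; simp [Pi.single_eq_of_ne hS]
        · simp
      · refine ⟨Pi.single L.toFinset (-p), ?_⟩
        rw [Finset.sum_eq_single L.toFinset, Pi.single_eq_same, h, oddProd]
        · simp
        · intro S _ hS; simp [Pi.single_eq_of_ne hS]
        · simp
    · exact ⟨0, by simp [oddMono_eq_zero hL]⟩
  | h0 => exact ⟨0, by simp⟩
  | ha a b h1 h2 =>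
    obtain ⟨p, hp⟩ := h1
    obtain ⟨q, hq⟩ := h2
    exact ⟨p + q, by simp [hp, hq, add_mul, Finset.sum_add_distrib]⟩
  | hs r a h1 =>
    obtain ⟨p, hp⟩ := h1
    exact ⟨r • p, by simp [hp, Finset.smul_sum]⟩

open Classical in
theorem topCoeff_oddProd_mul {S T : Finset (OddGen deg)} (h : T ≠ Sᶜ) :
    topCoeff (oddProd S * oddProd T) = 0 := by
  rw [oddProd, oddProd, ← oddMono_append]
  by_cases hn : (S.toList ++ T.toList).Nodup
  · refine topCoeff_oddMono_of_length_ne fun hl => h ?_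
    rw [List.length_append, Finset.length_toList, Finset.length_toList] at hl
    have hd : Disjoint S T := Finset.disjoint_left.2 fun i hi hj =>
      List.disjoint_of_nodup_append hn (Finset.mem_toList.2 hi) (Finset.mem_toList.2 hj)
    refine Finset.eq_of_subset_of_card_le (Finset.subset_compl_iff_disjoint_left.2 hd) ?_
    rw [Finset.card_compl]; omega
  · rw [oddMono_eq_zero hn, map_zero]

open Classical in
theorem topCoeff_oddProd_mul_compl (S : Finset (OddGen deg)) :
    topCoeff (oddProd S * oddProd Sᶜ) * topCoeff (oddProd S * oddProd Sᶜ) = 1 := by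
  rw [oddProd, oddProd, ← oddMono_append]
  refine topCoeff_oddMono_full ?_ ?_
  · refine List.nodup_append.2 ⟨Finset.nodup_toList _, Finset.nodup_toList _, ?_⟩
    rintro i hi j hj rfl
    simp at hi hj
    exact hj hi
  · simp [Finset.card_add_card_compl]

open Classical in
/-- The right dual basis of the products of odd generators, for the form `topCoeff (a * b)`. -/
noncomputable def dualRight (S : Finset (OddGen deg)) : FreeCGA deg :=
  ev (topCoeff (oddProd S * oddProd Sᶜ)) * oddProd Sᶜ

open Classical in
/-- The left dual basis of the products of odd generators, for the form `topCoeff (a * b)`. -/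
noncomputable def dualLeft (S : Finset (OddGen deg)) : FreeCGA deg :=
  ev (topCoeff (oddProd Sᶜ * oddProd S)) * oddProd Sᶜ

/-- Only complementary sets of odd generators multiply to a nonzero top coefficient, so pairing an
expansion of `a` with `dualRight S` isolates its coefficient at `S`; the sign built into `dualRight`
cancels. Thus ΛW is free over the even polynomials on the products `oddProd S`. -/
theorem sum_dualRight (a : FreeCGA deg) :
    ∑ S, ev (topCoeff (a * dualRight S)) * oddProd S = a := by
  classical
  obtain ⟨p, hp⟩ := exists_expansion a
  nth_rewrite 2 [hp]
  refine Finset.sum_congr rfl fun S _ => ?_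
  congr 2
  rw [dualRight, mul_ev_mul, topCoeff_ev_mul, hp, Finset.sum_mul, map_sum,
    Finset.sum_eq_single S, mul_assoc, topCoeff_ev_mul, mul_left_comm, topCoeff_oddProd_mul_compl,
    mul_one]
  · intro T _ hT
    rw [mul_assoc, topCoeff_ev_mul, topCoeff_oddProd_mul, mul_zero]
    exact fun h => hT (compl_injective h).symm
  · simp

theorem sum_dualLeft (a : FreeCGA deg) :
    ∑ S, ev (topCoeff (dualLeft S * a)) * oddProd S = a := by
  classical
  obtain ⟨p, hp⟩ := exists_expansion a
  nth_rewrite 2 [hp]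
  refine Finset.sum_congr rfl fun S _ => ?_
  congr 2
  have h := topCoeff_oddProd_mul_compl Sᶜ
  rw [compl_compl] at h
  rw [dualLeft, mul_assoc, topCoeff_ev_mul, hp, Finset.mul_sum, map_sum,
    Finset.sum_eq_single S, mul_ev_mul, topCoeff_ev_mul, mul_left_comm, h, mul_one]
  · intro T _ hT
    rw [mul_ev_mul, topCoeff_ev_mul, topCoeff_oddProd_mul, mul_zero]
    rwa [compl_compl]
  · simp

/-- Extracting the top coefficient removes each odd generator exactly once, and so lowers the degree
by the sum of the odd degrees. -/
theorem topCoeff_mono (l : List ι) : topCoeff (mono deg l) = 0 ∨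
    ∃ k, wt deg l = k + ∑ i : OddGen deg, deg i ∧
      (topCoeff (mono deg l)).IsWeightedHomogeneous (fun i : EvenGen deg => deg i) k := by
  classical
  obtain ⟨p, L, k, h1, h2, h3⟩ := exists_mono_eq (deg := deg) l
  by_cases hL : L.Nodup
  · by_cases hc : L.length = Fintype.card (OddGen deg)
    · refine Or.inr ⟨k, ?_, ?_⟩
      · have e1 : L.toFinset = Finset.univ :=
          Finset.eq_univ_of_card _ (by rw [List.toFinset_card_of_nodup hL, hc])
        rw [h2, ← e1, List.sum_toFinset _ hL, wt, List.map_map]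
        rfl
      · rw [h1, topCoeff_ev_mul]
        have h4 := topCoeff_oddMono_full hL hc
        rcases mul_self_eq_one_iff.1 h4 with h | h
        · rw [h, mul_one]; exact h3
        · rw [h, mul_neg_one]
          intro d hd
          exact h3 (by simpa using hd)
    · left; rw [h1, topCoeff_ev_mul, topCoeff_oddMono_of_length_ne hc, mul_zero]
  · left; rw [h1, oddMono_eq_zero hL, mul_zero, map_zero]

/-- The elements all of whose multiples have their top coefficient in `J`. -/
def coeffIdeal (J : Ideal (EvenPoly deg)) : Submodule ℚ (FreeCGA deg) where
  carrier := {a | ∀ b, topCoeff (a * b) ∈ J}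
  zero_mem' := by simp
  add_mem' := fun {a a'} h h' b => by rw [add_mul, map_add]; exact add_mem (h b) (h' b)
  smul_mem' := fun r a h b => by
    rw [smul_mul_assoc, map_smul]; exact Submodule.smul_of_tower_mem _ r (h b)

theorem ev_mul_mem_coeffIdeal {J : Ideal (EvenPoly deg)} {p : EvenPoly deg} (hp : p ∈ J)
    (a : FreeCGA deg) : ev p * a ∈ coeffIdeal J := fun b => by
  rw [mul_assoc, topCoeff_ev_mul]; exact J.mul_mem_right _ hp

/-- By the dual basis, the coefficients of `a` are themselves top coefficients of multiples of `a`.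
Hence `coeffIdeal J` is the extension of `J` to ΛW, in particular a two-sided ideal. -/
theorem exists_of_mem_coeffIdeal {J : Ideal (EvenPoly deg)} {a : FreeCGA deg}
    (ha : a ∈ coeffIdeal J) : ∃ p : Finset (OddGen deg) → EvenPoly deg, (∀ S, p S ∈ J) ∧
      a = ∑ S, ev (p S) * oddProd S :=
  ⟨_, fun S => ha (dualRight S), (sum_dualRight a).symm⟩

theorem mul_mem_coeffIdeal {J : Ideal (EvenPoly deg)} {a : FreeCGA deg} (b : FreeCGA deg)
    (ha : a ∈ coeffIdeal J) : b * a ∈ coeffIdeal J := by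
  obtain ⟨p, hp, rfl⟩ := exists_of_mem_coeffIdeal ha
  rw [Finset.mul_sum]
  refine sum_mem fun S _ => ?_
  rw [mul_ev_mul]
  exact ev_mul_mem_coeffIdeal (hp S) _

theorem coeffIdeal_bot : coeffIdeal (⊥ : Ideal (EvenPoly deg)) = ⊥ := by
  rw [eq_bot_iff]
  intro a ha
  obtain ⟨p, hp, rfl⟩ := exists_of_mem_coeffIdeal ha
  exact (Submodule.mem_bot ℚ).2 (Finset.sum_eq_zero fun S _ => by
    rw [(Submodule.mem_bot _).1 (hp S), map_zero, zero_mul])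

/-! ### Top coefficients and the differential -/

section Derivation

variable (D : ι → FreeCGA deg) (hD : ∀ i, D i ∈ gr deg (deg i + 1))

theorem derivation_mem_coeffIdeal (hD0 : ∀ i, Even (deg i) → D i = 0)
    {J : Ideal (EvenPoly deg)} {a : FreeCGA deg} (ha : a ∈ coeffIdeal J) :
    derivation D hD a ∈ coeffIdeal J := by
  obtain ⟨p, hp, rfl⟩ := exists_of_mem_coeffIdeal ha
  rw [map_sum]
  refine sum_mem fun S _ => ?_
  rw [derivation_ev_mul D hD hD0]
  exact ev_mul_mem_coeffIdeal (hp S) _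

/-- By linearity over the even polynomials it suffices to treat d of `oddProd S`. A nonzero top
coefficient of weight `k` forces `k` plus the degrees of the generators outside `S` to equal 1.
Those degrees are at least 2, so `k = 1`, but weights of even polynomials are even. -/
theorem topCoeff_derivation (hdeg : ∀ i, 2 ≤ deg i) (hD0 : ∀ i, Even (deg i) → D i = 0)
    (a : FreeCGA deg) : topCoeff (derivation D hD a) = 0 := by
  classical
  obtain ⟨p, rfl⟩ := exists_expansion a
  rw [map_sum, map_sum]
  refine Finset.sum_eq_zero fun S _ => ?_
  rw [derivation_ev_mul D hD hD0, topCoeff_ev_mul]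
  refine mul_eq_zero_of_right _ ?_
  have h : gr deg (wt deg (S.toList.map Subtype.val) + 1) ≤ LinearMap.ker topCoeff := by
    rw [gr, Submodule.span_le]
    rintro _ ⟨l, hl, rfl⟩
    rcases topCoeff_mono (deg := deg) l with h | ⟨k, hk, hh⟩
    · exact h
    have hsum : wt deg (S.toList.map Subtype.val) + ∑ i ∈ Sᶜ, deg i =
        ∑ i : OddGen deg, deg i := by
      rw [← Finset.sum_add_sum_compl S, wt, List.map_map]
      congr 1
      exact Finset.sum_map_toList S fun i : OddGen deg => deg i
    have hS : ∑ i ∈ Sᶜ, deg i = 0 := by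
      by_contra hne
      obtain ⟨i, hi, -⟩ := Finset.exists_ne_zero_of_sum_ne_zero hne
      have h1 := Finset.single_le_sum (f := fun i : OddGen deg => deg i)
        (fun _ _ => Nat.zero_le _) hi
      have h2 := hdeg i
      omega
    refine LinearMap.mem_ker.2 (MvPolynomial.ext _ _ fun d => ?_)
    rw [MvPolynomial.coeff_zero]
    by_contra hne
    have h1 := hh hne
    rw [Finsupp.weight_apply] at h1
    have h2 : Even (d.sum fun i c => c • deg (i : ι)) :=
      Finset.even_sum _ fun i _ => i.2.mul_left _
    rw [h1, show k = 1 by omega] at h2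
    exact Nat.not_even_one h2
  exact h (derivation_mem D hD (mono_mem _))

end Derivation

end FreeCGA

/-! ### Ideals generated by powers of the variables -/

section PowIdeal

open MvPolynomial

variable {σ : Type*} (K : σ → ℕ)

/-- The ideal generated by the powers `X i ^ K i` for `i ∈ T`. -/
noncomputable def powIdeal (T : Finset σ) : Ideal (MvPolynomial σ ℚ) :=
  Ideal.span ((fun i => X i ^ K i) '' (T : Set σ))

theorem mem_powIdeal {T : Finset σ} {p : MvPolynomial σ ℚ} :
    p ∈ powIdeal K T ↔ ∀ m ∈ p.support, ∃ i ∈ T, K i ≤ m i := by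
  have h : (fun i => X i ^ K i : σ → MvPolynomial σ ℚ) '' (T : Set σ) =
      (fun s => monomial s 1) '' ((fun i => Finsupp.single i (K i)) '' (T : Set σ)) := by
    rw [Set.image_image]
    simp only [X_pow_eq_monomial]
  rw [powIdeal, h, mem_ideal_span_monomial_image]
  simp [Finsupp.single_le_iff]

theorem powIdeal_empty : powIdeal K ∅ = ⊥ := by
  simp [powIdeal]

theorem mem_powIdeal_insert [DecidableEq σ] {T : Finset σ} {j : σ} {p : MvPolynomial σ ℚ} :
    p ∈ powIdeal K (insert j T) ↔ ∃ a, ∃ q ∈ powIdeal K T, p = a * X j ^ K j + q := by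
  rw [powIdeal, Finset.coe_insert, Set.image_insert_eq, Ideal.mem_span_insert]
  rfl

/-- Multiplying by a power of `X j` leaves the exponents indexed by `T` unchanged, so the powers
form a regular sequence in any order. -/
theorem mem_powIdeal_of_mul_mem {T : Finset σ} {j : σ} (hj : j ∉ T) {p : MvPolynomial σ ℚ}
    (h : X j ^ K j * p ∈ powIdeal K T) : p ∈ powIdeal K T := by
  rw [mem_powIdeal] at h ⊢
  intro m hm
  obtain ⟨i, hi, him⟩ := h (Finsupp.single j (K j) + m) (by
    rw [mem_support_iff, X_pow_eq_monomial, coeff_monomial_mul, one_mul]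
    exact mem_support_iff.1 hm)
  refine ⟨i, hi, ?_⟩
  have hne : j ≠ i := fun h => hj (h ▸ hi)
  simpa [Finsupp.single_eq_of_ne hne.symm] using him

/-! ### The truncated polynomial algebra is Frobenius -/

variable [Fintype σ]

/-- The exponent of the socle monomial of the quotient by all the powers `X i ^ K i`. -/
noncomputable def socleExp : σ →₀ ℕ := Finsupp.equivFunOnFinite.symm fun i => K i - 1

@[simp] theorem socleExp_apply (i : σ) : socleExp K i = K i - 1 := rfl

variable {K}

theorem coeff_socleExp_eq_zero (hK : ∀ i, 0 < K i) {p : MvPolynomial σ ℚ}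
    (hp : p ∈ powIdeal K Finset.univ) : coeff (socleExp K) p = 0 := by
  by_contra h
  obtain ⟨i, -, hi⟩ := (mem_powIdeal K).1 hp _ (mem_support_iff.2 h)
  have := hK i
  rw [socleExp_apply] at hi
  omega

theorem le_socleExp {m : σ →₀ ℕ} (hm : ¬ ∃ i ∈ Finset.univ, K i ≤ m i) : m ≤ socleExp K := by
  intro i
  have : m i < K i := by
    by_contra h
    exact hm ⟨i, Finset.mem_univ i, not_lt.1 h⟩
  rw [socleExp_apply]
  omega

theorem mem_powIdeal_of_coeff {p : MvPolynomial σ ℚ}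
    (hp : ∀ q, coeff (socleExp K) (q * p) = 0) : p ∈ powIdeal K Finset.univ := by
  rw [mem_powIdeal]
  intro m hm
  by_contra hcon
  have hle := le_socleExp hcon
  -- The complementary monomial carries the exponent `m` to the socle, so the pairing reads off the
  -- coefficient of `p` at `m`.
  have h := hp (monomial (socleExp K - m) 1)
  rw [coeff_monomial_mul', if_pos tsub_le_self, tsub_tsub_cancel_of_le hle, one_mul] at h
  exact mem_support_iff.1 hm h

theorem exists_coeff_eq (g : MvPolynomial σ ℚ →ₗ[ℚ] ℚ)
    (hg : ∀ p ∈ powIdeal K Finset.univ, g p = 0) :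
    ∃ p, ∀ q, g q = coeff (socleExp K) (p * q) := by
  classical
  -- The monomials dividing the socle have their complements as dual basis, and `g` is expanded in
  -- it.
  refine ⟨∑ m ∈ Finset.Iic (socleExp K), monomial (socleExp K - m) (g (monomial m 1)), fun q => ?_⟩
  set p := ∑ m ∈ Finset.Iic (socleExp K), monomial (socleExp K - m) (g (monomial m 1)) with hp
  have h : g = lcoeff ℚ (socleExp K) ∘ₗ LinearMap.mulLeft ℚ p := by
    refine (basisMonomials σ ℚ).ext fun s => ?_
    rw [coe_basisMonomials, LinearMap.comp_apply, LinearMap.mulLeft_apply, lcoeff_apply,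
      coeff_mul_monomial', mul_one]
    split_ifs with hs
    · rw [hp, coeff_sum, Finset.sum_eq_single s]
      · rw [coeff_monomial, if_pos rfl]
      · intro m hm hne
        rw [coeff_monomial, if_neg]
        intro he
        refine hne ?_
        rw [← tsub_tsub_cancel_of_le (Finset.mem_Iic.1 hm), he, tsub_tsub_cancel_of_le hs]
      · intro hs'
        exact absurd (Finset.mem_Iic.2 hs) hs'
    · refine hg _ ((mem_powIdeal K).2 fun m hm => ?_)
      rw [support_monomial, if_neg one_ne_zero, Finset.mem_singleton] at hm
      subst hm
      by_contra hcon
      exact hs (le_socleExp hcon)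
  exact DFunLike.congr_fun h q

end PowIdeal

/-! ### Poincaré duality for free algebras with closed even generators -/

namespace FreeCGA

variable {ι : Type u} {deg : ι → ℕ} (D : ι → FreeCGA deg)
  (hD : ∀ i, D i ∈ gr deg (deg i + 1))

/-- Take for `h'` the element `h` with its odd part negated; this cancels the sign in the Leibniz
rule. -/
theorem exists_leibniz (h : FreeCGA deg) :
    ∃ h', ∀ b, derivation D hD (h' * b) = derivation D hD h' * b + h * derivation D hD b := by
  induction h using induction_mono with
  | h l =>
    rcases neg_one_pow_eq_or (FreeCGA deg) (wt deg l) with hs | hs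
    · exact ⟨mono deg l, fun b => by rw [derivation_mono_mul, hs, one_mul]⟩
    · exact ⟨-mono deg l, fun b => by
        rw [neg_mul, map_neg, map_neg, derivation_mono_mul, hs]; simp [add_comm]⟩
  | h0 => exact ⟨0, by simp⟩
  | ha a b h1 h2 =>
    obtain ⟨a', h1⟩ := h1
    obtain ⟨b', h2⟩ := h2
    exact ⟨a' + b', fun c => by simp only [add_mul, map_add, h1, h2]; abel⟩
  | hs r a h1 =>
    obtain ⟨a', h1⟩ := h1
    exact ⟨r • a', fun c => by simp only [smul_mul_assoc, map_smul, h1, smul_add]⟩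

/-- Up to sign `w` moves past each monomial of `a`, and an odd element squares to zero over ℚ. -/
theorem mul_mul_self_eq_zero {n : ℕ} (hn : Odd n) {w : FreeCGA deg} (hw : w ∈ gr deg n)
    (a : FreeCGA deg) : w * a * w = 0 := by
  have hww : w * w = 0 := by
    have h := comm hw hw
    rw [sign_odd (hn.mul hn)] at h
    have h2 : (2 : ℚ) • (w * w) = 0 := by
      rw [two_smul]; exact eq_neg_iff_add_eq_zero.1 h
    exact (smul_eq_zero_iff_right two_ne_zero).1 h2
  induction a using induction_mono with
  | h l =>
    rw [mul_assoc, comm (mono_mem l) hw]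
    rcases neg_one_pow_eq_or (FreeCGA deg) (wt deg l * n) with hs | hs <;>
      simp [hs, ← mul_assoc, hww]
  | h0 => simp
  | ha a b h1 h2 => rw [mul_add, add_mul, h1, h2, add_zero]
  | hs r a h => rw [mul_smul_comm, smul_mul_assoc, h, smul_zero]

variable (deg) in
theorem one_ne_zero' : (1 : FreeCGA deg) ≠ 0 := by
  intro h
  have h' := congrArg (lift (deg := deg) (fun _ => (0 : ℚ)) (by simp)) h
  rw [map_one, map_zero] at h'
  exact one_ne_zero h'

theorem exists_eq_smul_one (hdeg : ∀ i, 2 ≤ deg i) {a : FreeCGA deg} (ha : a ∈ gr deg 0) :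
    ∃ q : ℚ, a = q • (1 : FreeCGA deg) := by
  induction ha using Submodule.span_induction with
  | mem a ha =>
    obtain ⟨l, hl, rfl⟩ := ha
    cases l with
    | nil => exact ⟨1, (one_smul _ _).symm⟩
    | cons i l => have := hdeg i; rw [wt_cons] at hl; omega
  | zero => exact ⟨0, (zero_smul _ _).symm⟩
  | add a b _ _ h1 h2 =>
    obtain ⟨q, rfl⟩ := h1
    obtain ⟨r, rfl⟩ := h2
    exact ⟨q + r, (add_smul _ _ _).symm⟩
  | smul r a _ h1 =>
    obtain ⟨q, rfl⟩ := h1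
    exact ⟨r * q, (mul_smul _ _ _).symm⟩

/-! ### From the Frobenius quotient to duality on cohomology -/

variable [Fintype ι]

/-- The coefficient of the product of the socle monomial and all odd generators. -/
noncomputable def socleCoeff (K : EvenGen deg → ℕ) : FreeCGA deg →ₗ[ℚ] ℚ :=
  MvPolynomial.lcoeff ℚ (socleExp K) ∘ₗ topCoeff

/-- The form pairs the Frobenius form of truncated polynomials with the top coefficient form of the
odd generators, and both are perfect. -/
theorem isDualizing_socleCoeff (hdeg : ∀ i, 2 ≤ deg i) (hD0 : ∀ i, Even (deg i) → D i = 0)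
    {K : EvenGen deg → ℕ} (hK : ∀ i, 0 < K i) :
    IsDualizing (derivation D hD) (coeffIdeal (powIdeal K Finset.univ)) (socleCoeff K) := by
  refine IsDualizing.of_frobenius ?_ ?_ (exists_leibniz D hD) ?_ ?_
  · intro a ha
    have h := ha 1
    rw [mul_one] at h
    exact coeff_socleExp_eq_zero hK h
  · intro a
    rw [socleCoeff, LinearMap.comp_apply, topCoeff_derivation D hD hdeg hD0, map_zero]
  · intro g hg
    have hS : ∀ S : Finset (OddGen deg), ∃ p : EvenPoly deg, ∀ q : EvenPoly deg,
        g (ev q * oddProd S) = MvPolynomial.coeff (socleExp K) (p * q) := fun S =>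
      exists_coeff_eq (g ∘ₗ LinearMap.mulRight ℚ (oddProd S) ∘ₗ ev.toLinearMap)
        fun p hp => hg _ (ev_mul_mem_coeffIdeal hp _)
    choose p hp using hS
    -- `p S` represents `g` on the summand at `S`, and `dualLeft S` extracts the coefficient there.
    refine ⟨∑ S, ev (p S) * dualLeft S, fun m => ?_⟩
    nth_rewrite 1 [← sum_dualLeft m]
    rw [map_sum, Finset.sum_mul, map_sum]
    refine Finset.sum_congr rfl fun S _ => ?_
    rw [hp, mul_assoc, socleCoeff, LinearMap.comp_apply, topCoeff_ev_mul]
    rfl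
  · intro a ha b
    refine mem_powIdeal_of_coeff fun q => ?_
    rw [← topCoeff_ev_mul, ← mul_ev_mul]
    exact ha _

theorem socleCoeff_eq_zero (K : EvenGen deg → ℕ) {n : ℕ} {a : FreeCGA deg} (ha : a ∈ gr deg n)
    (hn : n ≠ ∑ i : EvenGen deg, (K i - 1) * deg i + ∑ i : OddGen deg, deg i) :
    socleCoeff K a = 0 := by
  have h : gr deg n ≤ LinearMap.ker (socleCoeff K) := by
    rw [gr, Submodule.span_le]
    rintro _ ⟨l, hl, rfl⟩
    refine LinearMap.mem_ker.2 ?_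
    rw [socleCoeff, LinearMap.comp_apply]
    rcases topCoeff_mono (deg := deg) l with h | ⟨k, hk, hh⟩
    · rw [h, map_zero]
    · by_contra hne
      have h1 := hh hne
      rw [Finsupp.weight_apply, Finsupp.sum_fintype _ _ (by simp)] at h1
      refine hn ?_
      rw [← hl, hk, ← h1]
      rfl
  exact h ha

theorem mem_coeffIdeal_insert [DecidableEq ι] (K : EvenGen deg → ℕ) {T : Finset (EvenGen deg)}
    {j : EvenGen deg} (a : FreeCGA deg) : a ∈ coeffIdeal (powIdeal K (insert j T)) ↔
      ∃ e ∈ coeffIdeal (powIdeal K T), ∃ m, a = e + ev (MvPolynomial.X j ^ K j) * m := by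
  constructor
  · intro ha
    obtain ⟨p, hp, rfl⟩ := exists_of_mem_coeffIdeal ha
    choose r q hq hpq using fun S => (mem_powIdeal_insert K).1 (hp S)
    refine ⟨∑ S, ev (q S) * oddProd S, sum_mem fun S _ => ev_mul_mem_coeffIdeal (hq S) _,
      ∑ S, ev (r S) * oddProd S, ?_⟩
    rw [Finset.mul_sum, ← Finset.sum_add_distrib]
    refine Finset.sum_congr rfl fun S _ => ?_
    rw [hpq, map_add, mul_comm (r S), map_mul, add_mul, mul_assoc, add_comm]
  · rintro ⟨e, he, m, rfl⟩
    refine add_mem (fun b => ?_) (ev_mul_mem_coeffIdeal ?_ _)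
    · exact (mem_powIdeal_insert K).2 ⟨0, _, he b, by simp⟩
    · exact (mem_powIdeal_insert K).2 ⟨1, 0, zero_mem _, by simp⟩

theorem finite_gr (hdeg : ∀ i, 2 ≤ deg i) (n : ℕ) : Module.Finite ℚ (gr deg n) := by
  refine Module.Finite.span_of_finite ℚ (Set.Finite.subset
    ((List.finite_length_le ι n).image (mono deg)) ?_)
  rintro _ ⟨l, hl, rfl⟩
  refine ⟨l, ?_, rfl⟩
  have h : ∀ l : List ι, l.length ≤ wt deg l := fun l => by
    induction l with
    | nil => simp
    | cons i l ih => have := hdeg i; rw [wt_cons, List.length_cons]; omega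
  exact hl ▸ h l

/-- A free graded commutative algebra on finitely many generators of degrees at least two, whose
even generators are closed and nilpotent in cohomology, satisfies Poincaré duality. -/
theorem hasFormalDimension (hDD : ∀ i, derivation D hD (D i) = 0) (hdeg : ∀ i, 2 ≤ deg i)
    (hD0 : ∀ i, Even (deg i) → D i = 0)
    (hnil : ∀ i, Even (deg i) → ∃ k, 0 < k ∧ ∃ w, derivation D hD w = gen deg i ^ k) {n : ℕ}
    (hn : n + ∑ i : EvenGen deg, (deg i - 1) = ∑ i : OddGen deg, deg i) :
    (toCDGA D hD hDD).HasFormalDimension n := by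
  classical
  choose K hK hw using fun i : EvenGen deg => hnil i i.2
  have hpos : ∀ i, 2 ≤ K i * deg i := fun i =>
    (hdeg i).trans (Nat.le_mul_of_pos_left _ (hK i))
  -- `T` is the set of variables whose powers are still in the ideal. Removing `j` lowers the degree
  -- of ε by that of `w_j`, namely `K j * deg j - 1`.
  have main : ∀ T : Finset (EvenGen deg),
      (∃ ε, IsDualizing (derivation D hD) (coeffIdeal (powIdeal K T)) ε ∧
        ∀ i, ∀ a ∈ gr deg i, i ≠ n + ∑ j ∈ T, (K j * deg j - 1) → ε a = 0) →
      ∃ ε, IsDualizing (derivation D hD) (⊥ : Submodule ℚ (FreeCGA deg)) ε ∧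
        ∀ i, ∀ a ∈ gr deg i, i ≠ n → ε a = 0 := by
    intro T
    induction T using Finset.induction_on with
    | empty => simp [powIdeal_empty, coeffIdeal_bot]
    | insert j T hj ih =>
      rintro ⟨ε, h1, h2⟩
      have hev : ev (MvPolynomial.X j ^ K j) = gen deg (j : ι) ^ K j := by rw [map_pow, ev_X]
      obtain ⟨w, hwd⟩ := hw j
      have hdegw : K j * deg j - 1 + 1 = K j * deg j := by have := hpos j; omega
      -- A homogeneous primitive has odd degree, which gives both the Leibniz sign and `w * a * w =
      -- 0` required by `descend`.
      obtain ⟨w, hwm, hwd⟩ := CDGA.exists_homogeneous_primitive (M := toCDGA D hD hDD)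
        (n := K j * deg j - 1) (a := gen deg (j : ι) ^ K j) (b := w) (by
          rw [hdegw, ← smul_eq_mul]
          exact SetLike.pow_mem_graded (A := gr deg) _ (gen_mem (j : ι))) hwd
      change w ∈ gr deg _ at hwm
      change derivation D hD w = _ at hwd
      have hodd : Odd (K j * deg j - 1) := by
        have h : Even (K j * deg j) := j.2.mul_left _
        rw [← hdegw, Nat.even_add_one] at h
        exact Nat.not_even_iff_odd.1 h
      refine ih ⟨_, h1.descend (ev (MvPolynomial.X j ^ K j)) w
        (derivation_derivation D hD hDD) (mem_coeffIdeal_insert K) ?_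
        (derivation_ev_mul D hD hD0 _) ?_
        (fun a => derivation_mem_coeffIdeal D hD hD0) (fun a => mul_mem_coeffIdeal w)
        (mul_mul_self_eq_zero hodd hwm), ?_⟩
      · intro b
        rw [derivation_mul D hD b hwm, hwd, hev, sign_odd hodd, sub_eq_add_neg]
      · intro m hm b
        refine mem_powIdeal_of_mul_mem K hj ?_
        rw [← topCoeff_ev_mul, ← mul_assoc]
        exact hm b
      · intro i a ha hi
        refine h2 _ _ (mul_mem hwm ha) fun h => hi ?_
        rw [Finset.sum_insert hj] at h
        omega
  obtain ⟨ε, h1, h2⟩ := main Finset.univ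
    ⟨socleCoeff K, isDualizing_socleCoeff D hD hdeg hD0 hK, fun i a ha hi =>
      -- The degrees match because `(K j - 1) * deg j + (deg j - 1) = K j * deg j - 1`, where
      -- positivity of `K j` makes the truncated subtractions exact.
      socleCoeff_eq_zero K ha fun h => hi (by
        rw [h, ← hn, add_left_comm, ← Finset.sum_add_distrib]
        congr 1
        refine Finset.sum_congr rfl fun j _ => ?_
        have h3 := hdeg j
        obtain ⟨k, hk⟩ := Nat.exists_eq_succ_of_ne_zero (hK j).ne'
        rw [hk, Nat.succ_sub_one, Nat.succ_mul]
        omega)⟩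
  refine CDGA.hasFormalDimension_of_isDualizing (M := toCDGA D hD hDD) h1 h2 (finite_gr hdeg)
    (one_ne_zero' deg) fun a => exists_eq_smul_one hdeg

end FreeCGA

theorem finite_directSum {N : ℕ → Type*} [∀ r, AddCommGroup (N r)] [∀ r, Module ℚ (N r)]
    [∀ r, Module.Finite ℚ (N r)] (k : ℕ) (h : ∀ r, k < r → Subsingleton (N r)) :
    Module.Finite ℚ (⨁ r, N r) := by
  refine Module.Finite.of_injective
    (LinearMap.pi fun r : Fin (k + 1) => DirectSum.component ℚ ℕ N r) fun a b hab => ?_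
  refine DFinsupp.ext fun r => ?_
  by_cases hr : r < k + 1
  · exact congrFun hab ⟨r, hr⟩
  · have := h r (by omega)
    exact Subsingleton.elim _ _

/-! ### The algebra of a graph -/

namespace FreeCGA

variable {ι : Type u} {deg : ι → ℕ}

/-- The polynomials in the even generators which are coboundaries. -/
def exactIdeal (D : ι → FreeCGA deg) (hD : ∀ i, D i ∈ gr deg (deg i + 1))
    (hD0 : ∀ i, Even (deg i) → D i = 0) : Ideal (EvenPoly deg) where
  carrier := {p | ∃ w, derivation D hD w = ev p}
  zero_mem' := ⟨0, by simp⟩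
  add_mem' := by
    rintro p q ⟨v, hv⟩ ⟨w, hw⟩
    exact ⟨v + w, by rw [map_add, map_add, hv, hw]⟩
  smul_mem' := by
    rintro p q ⟨w, hw⟩
    exact ⟨ev p * w, by rw [derivation_ev_mul D hD hD0, hw, smul_eq_mul, map_mul]⟩

end FreeCGA

namespace Gen

open FreeCGA

variable {V : Type u}

/-- The generators as a disjoint union. -/
def equivSum : Gen V ≃ (Fin 6 ⊕ V) ⊕ V where
  toFun
    | x₁ => .inl (.inl 0)
    | x₂ => .inl (.inl 1)
    | y₁ => .inl (.inl 2)
    | y₂ => .inl (.inl 3)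
    | y₃ => .inl (.inl 4)
    | z => .inl (.inl 5)
    | xv v => .inl (.inr v)
    | zv v => .inr v
  invFun
    | .inl (.inl 0) => x₁
    | .inl (.inl 1) => x₂
    | .inl (.inl 2) => y₁
    | .inl (.inl 3) => y₂
    | .inl (.inl 4) => y₃
    | .inl (.inl 5) => z
    | .inl (.inr v) => xv v
    | .inr v => zv v
  left_inv i := by cases i <;> rfl
  right_inv i := by
    rcases i with (i | v) | v
    · fin_cases i <;> rfl
    · rfl
    · rfl

instance [Fintype V] : Fintype (Gen V) := Fintype.ofEquiv _ equivSum.symm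

theorem sum_eq [Fintype V] (f : Gen V → ℕ) : ∑ i, f i =
    f x₁ + f x₂ + f y₁ + f y₂ + f y₃ + f z + ∑ v, f (xv v) + ∑ v, f (zv v) := by
  rw [← equivSum.symm.sum_comp, Fintype.sum_sum_type, Fintype.sum_sum_type, Fin.sum_univ_six]
  rfl

theorem two_le_deg (i : Gen V) : 2 ≤ deg i := by
  cases i <;> simp [deg]

/-- The odd degrees add up to 33 + 35 + 37 + 119 + 119|V| = 224 + 119|V|; the even ones, each
lowered by 1, to 7 + 9 + 39|V|. -/
theorem sum_deg [Fintype V] : (208 + 80 * Fintype.card V) +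
    ∑ i : EvenGen (deg (V := V)), (deg (i : Gen V) - 1) =
    ∑ i : OddGen (deg (V := V)), deg (i : Gen V) := by
  rw [← Finset.sum_subtype (Finset.univ.filter fun i : Gen V => Even (deg i)) (by simp)
      (fun i => deg i - 1), ← Finset.sum_subtype
      (Finset.univ.filter fun i : Gen V => ¬ Even (deg i)) (by simp) (fun i => deg i),
    Finset.sum_filter, Finset.sum_filter, sum_eq, sum_eq]
  simp [deg, Nat.even_iff]
  omega

/-- The polynomial variable `x₁`. -/
noncomputable def X₁ : EvenPoly (deg (V := V)) := MvPolynomial.X ⟨x₁, show Even 8 by decide⟩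

/-- The polynomial variable `x₂`. -/
noncomputable def X₂ : EvenPoly (deg (V := V)) := MvPolynomial.X ⟨x₂, show Even 10 by decide⟩

/-- The polynomial variable `x_v`. -/
noncomputable def Xv (v : V) : EvenPoly (deg (V := V)) :=
  MvPolynomial.X ⟨xv v, show Even 40 by decide⟩

theorem ev_X₁ : ev (X₁ (V := V)) = x₁.el := ev_X _
theorem ev_X₂ : ev (X₂ (V := V)) = x₂.el := ev_X _
theorem ev_Xv (v : V) : ev (Xv v) = (xv v).el := ev_X _

/-- The part of `d z` involving the generators `y₁, y₂, y₃`. -/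
noncomputable def quadPart : FreeCGA (deg (V := V)) :=
  ev (X₁ ^ 4 * X₂ ^ 2) * (y₁.el * y₂.el) - ev (X₁ ^ 5 * X₂) * (y₁.el * y₃.el)
    + ev (X₁ ^ 6) * (y₂.el * y₃.el)

/-- Any two of the products `y₁y₂`, `y₁y₃`, `y₂y₃` share an odd factor. -/
theorem quadPart_mul_self : (quadPart : FreeCGA (deg (V := V))) * quadPart = 0 := by
  have h1 : ∀ a : FreeCGA (deg (V := V)), y₁.el * a * y₁.el = 0 :=
    mul_mul_self_eq_zero (show Odd 33 by decide) y₁_mem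
  have h2 : ∀ a : FreeCGA (deg (V := V)), y₂.el * a * y₂.el = 0 :=
    mul_mul_self_eq_zero (show Odd 35 by decide) y₂_mem
  have h3 : ∀ a : FreeCGA (deg (V := V)), y₃.el * a * y₃.el = 0 :=
    mul_mul_self_eq_zero (show Odd 37 by decide) y₃_mem
  have key : ∀ (p q : EvenPoly (deg (V := V))) (a b : FreeCGA (deg (V := V))), a * b = 0 →
      ev p * a * (ev q * b) = 0 := fun p q a b h => by
    rw [mul_ev_mul, mul_assoc, h, mul_zero, mul_zero]
  -- The four cases `hl`, `hr`, `ho`, `hm` differ in where the repeated factor sits in the product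
  -- of four.
  have hl : ∀ a b c e : FreeCGA (deg (V := V)), a * b * c = 0 → a * b * (c * e) = 0 :=
    fun a b c e h => by rw [← mul_assoc, h, zero_mul]
  have hr : ∀ a b c e : FreeCGA (deg (V := V)), b * c * e = 0 → a * b * (c * e) = 0 :=
    fun a b c e h => by rw [mul_assoc, ← mul_assoc b, h, mul_zero]
  have ho : ∀ a b c : FreeCGA (deg (V := V)), a * (b * c) * a = 0 → a * b * (c * a) = 0 :=
    fun a b c h => by rwa [← mul_assoc, mul_assoc a b c]
  have hm : ∀ a b c : FreeCGA (deg (V := V)), b * 1 * b = 0 → a * b * (b * c) = 0 :=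
    fun a b c h => by rw [mul_one] at h; rw [mul_assoc, ← mul_assoc b, h, zero_mul, mul_zero]
  simp only [quadPart, add_mul, sub_mul, mul_add, mul_sub]
  rw [key _ _ _ _ (hl _ _ _ _ (h1 _)), key _ _ _ _ (hl _ _ _ _ (h1 _)),
    key _ _ _ _ (hm _ _ _ (h2 _)), key _ _ _ _ (hl _ _ _ _ (h1 _)),
    key _ _ _ _ (hl _ _ _ _ (h1 _)), key _ _ _ _ (hr _ _ _ _ (h3 _)),
    key _ _ _ _ (ho _ _ _ (h2 _)), key _ _ _ _ (hr _ _ _ _ (h3 _)),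
    key _ _ _ _ (hl _ _ _ _ (h2 _))]
  simp

/-! ### The differential of the graph algebra and nilpotence of its even generators -/

variable [Fintype V] (G : SimpleGraph V)

theorem diff_even (i : Gen V) (hi : Even (deg i)) : diff G i = 0 := by
  cases i with
  | x₁ | x₂ | xv => rfl
  | y₁ | y₂ | y₃ | z | zv => simp [deg, Nat.even_iff] at hi

theorem diff_mem_adjoin (i : Gen V) :
    diff G i ∈ Algebra.adjoin ℚ {a | ∃ j : Gen V, deg j < deg i ∧ j.el = a} := by
  have h : ∀ j : Gen V, deg j < deg i →
      j.el ∈ Algebra.adjoin ℚ {a | ∃ j : Gen V, deg j < deg i ∧ j.el = a} :=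
    fun j hj => Algebra.subset_adjoin ⟨j, hj, rfl⟩
  cases i with
  | x₁ | x₂ | xv => exact zero_mem _
  | y₁ => exact mul_mem (pow_mem (h x₁ (by simp [deg])) _) (h x₂ (by simp [deg]))
  | y₂ => exact mul_mem (pow_mem (h x₁ (by simp [deg])) _) (pow_mem (h x₂ (by simp [deg])) _)
  | y₃ => exact mul_mem (h x₁ (by simp [deg])) (pow_mem (h x₂ (by simp [deg])) _)
  | z =>
    have hx₁ := h x₁ (by simp [deg])
    have hx₂ := h x₂ (by simp [deg])
    have hy₁ := h y₁ (by simp [deg])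
    have hy₂ := h y₂ (by simp [deg])
    have hy₃ := h y₃ (by simp [deg])
    exact add_mem (add_mem (add_mem (sub_mem
      (mul_mem (mul_mem (mul_mem hy₁ hy₂) (pow_mem hx₁ _)) (pow_mem hx₂ _))
      (mul_mem (mul_mem (mul_mem hy₁ hy₃) (pow_mem hx₁ _)) hx₂))
      (mul_mem (mul_mem hy₂ hy₃) (pow_mem hx₁ _))) (pow_mem hx₁ _)) (pow_mem hx₂ _)
  | zv v =>
    have hx : ∀ w, (xv w).el ∈ _ := fun w => h (xv w) (by simp [deg])
    exact add_mem (pow_mem (hx v) _) (sum_mem fun w _ =>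
      mul_mem (mul_mem (hx v) (hx w)) (pow_mem (h x₂ (by simp [deg])) _))

theorem diff_mem_decomposable {W : Submodule ℚ (FreeCGA (deg (V := V)))}
    (hW : ∀ i : Gen V, i.el ∈ W) (i : Gen V) : diff G i ∈ W * W * (⊤ : Submodule ℚ _) := by
  have h : ∀ (j k : Gen V) (a : FreeCGA (deg (V := V))), j.el * k.el * a ∈ W * W * ⊤ :=
    fun j k a => Submodule.mul_mem_mul (Submodule.mul_mem_mul (hW j) (hW k)) trivial
  have hpow : ∀ (j : Gen V) (n : ℕ) (a : FreeCGA (deg (V := V))),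
      j.el ^ (n + 2) * a ∈ W * W * ⊤ := fun j n a => by
    have := h j j (j.el ^ n * a)
    rwa [← mul_assoc, ← sq j.el, ← pow_add, add_comm] at this
  have hpow' : ∀ (j : Gen V) (n : ℕ), j.el ^ (n + 2) ∈ W * W * ⊤ := fun j n => by
    simpa using hpow j n 1
  cases i with
  | x₁ | x₂ | xv => exact zero_mem _
  | y₁ => exact hpow x₁ 1 _
  | y₂ => exact hpow x₁ 0 _
  | y₃ =>
    have := h x₁ x₂ (x₂.el ^ 2)
    rwa [mul_assoc x₁.el, ← pow_succ'] at this
  | z =>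
    refine add_mem (add_mem (add_mem (sub_mem ?_ ?_) ?_) (hpow' x₁ 13)) (hpow' x₂ 10)
    · rw [mul_assoc (y₁.el * y₂.el)]; exact h _ _ _
    · rw [mul_assoc (y₁.el * y₃.el)]; exact h _ _ _
    · exact h _ _ _
  | zv v => exact add_mem (hpow' (xv v) 1) (sum_mem fun w _ => h _ _ _)

/-- The ideal of the polynomials in the even generators which are coboundaries of `M_G`. -/
noncomputable abbrev exact : Ideal (EvenPoly (deg (V := V))) :=
  exactIdeal (diff G) (diff_mem G) (diff_even G)

theorem diff_z : diff G z = quadPart + ev (X₁ ^ 15) + ev (X₂ ^ 12) := by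
  simp only [diff, quadPart, map_mul, map_pow, ev_X₁, ev_X₂]
  have h1 := fun (p : EvenPoly (deg (V := V))) (a : FreeCGA (deg (V := V))) => ev_comm p a
  have e1 := h1 (X₁ ^ 4 * X₂ ^ 2)
  have e2 := h1 (X₁ ^ 5 * X₂)
  have e3 := h1 (X₁ ^ 6)
  simp only [map_mul, map_pow, ev_X₁, ev_X₂] at e1 e2 e3
  rw [mul_assoc (y₁.el * y₂.el), mul_assoc (y₁.el * y₃.el), e1, e2, e3]

local notation "∂" => FreeCGA.derivation (diff G) (diff_mem G)

theorem derivation_el (i : Gen V) : ∂ i.el = diff G i := derivation_gen _ _ i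

theorem derivation_y₁ : ∂ y₁.el = ev (X₁ ^ 3 * X₂) := by
  rw [derivation_el]; simp only [diff, map_mul, map_pow, ev_X₁, ev_X₂]

theorem derivation_y₂ : ∂ y₂.el = ev (X₁ ^ 2 * X₂ ^ 2) := by
  rw [derivation_el]; simp only [diff, map_mul, map_pow, ev_X₁, ev_X₂]

theorem derivation_y₃ : ∂ y₃.el = ev (X₁ * X₂ ^ 3) := by
  rw [derivation_el]; simp only [diff, map_mul, map_pow, ev_X₁, ev_X₂]

theorem derivation_ev (p : EvenPoly (deg (V := V))) (a : FreeCGA (deg (V := V))) :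
    ∂ (ev p * a) = ev p * ∂ a :=
  derivation_ev_mul _ _ (diff_even G) p a

theorem X₂_pow_mem : X₂ ^ 13 ∈ exact G := by
  have h : ∂ (y₁.el * (y₂.el * y₃.el)) = ev (X₁ ^ 3 * X₂) * (y₂.el * y₃.el)
      - ev (X₁ ^ 2 * X₂ ^ 2) * (y₁.el * y₃.el) + ev (X₁ * X₂ ^ 3) * (y₁.el * y₂.el) := by
    rw [derivation_mul _ _ _ y₁_mem, derivation_mul _ _ _ y₂_mem, derivation_y₁, derivation_y₂,
      derivation_y₃, sign_odd (by decide), sign_odd (by decide), ev_comm, mul_add, mul_neg,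
      mul_ev_mul, mul_ev_mul]
    abel
  -- In x₂ dz, the quadratic part is x₁³ d(y₁y₂y₃) and the term x₁¹⁵x₂ is x₁¹² dy₁; only x₂¹³
  -- survives.
  refine ⟨ev X₂ * z.el - ev (X₁ ^ 3) * (y₁.el * (y₂.el * y₃.el)) - ev (X₁ ^ 12) * y₁.el, ?_⟩
  rw [map_sub, map_sub, derivation_ev, derivation_ev, derivation_ev, h, derivation_y₁,
    derivation_el, diff_z, quadPart]
  simp only [mul_add, mul_sub, ← mul_assoc (ev _) (ev _), ← map_mul]
  rw [show (X₂ * (X₁ ^ 4 * X₂ ^ 2) : EvenPoly (deg (V := V))) = X₁ ^ 3 * (X₁ * X₂ ^ 3) by ring,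
    show (X₂ * (X₁ ^ 5 * X₂) : EvenPoly (deg (V := V))) = X₁ ^ 3 * (X₁ ^ 2 * X₂ ^ 2) by ring,
    show (X₂ * X₁ ^ 6 : EvenPoly (deg (V := V))) = X₁ ^ 3 * (X₁ ^ 3 * X₂) by ring,
    show (X₂ * X₁ ^ 15 : EvenPoly (deg (V := V))) = X₁ ^ 12 * (X₁ ^ 3 * X₂) by ring,
    show (X₂ ^ 13 : EvenPoly (deg (V := V))) = X₂ * X₂ ^ 12 by ring]
  abel

theorem X₁_pow_mem : X₁ ^ 32 ∈ exact G := by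
  have hq : (quadPart : FreeCGA (deg (V := V))) = diff G z - ev (X₁ ^ 15) - ev (X₂ ^ 12) := by
    rw [diff_z]; abel
  have hev : ∀ p : EvenPoly (deg (V := V)), ∂ (ev p) = 0 := fun p => by
    have := derivation_ev G p 1
    rwa [mul_one, derivation_one, mul_zero] at this
  have hdq : ∂ quadPart = 0 := by
    rw [hq, map_sub, map_sub, diff_closed, hev, hev]; simp
  have hmem : quadPart ∈ gr (deg (V := V)) 120 := by
    rw [hq, map_pow, map_pow, ev_X₁, ev_X₂]
    exact sub_mem (sub_mem (diff_mem G z) (pow_mem' x₁_mem 15 rfl)) (pow_mem' x₂_mem 12 rfl)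
  -- The term x₁x₂¹² of x₁ dz equals x₂⁹ dy₃.
  have hw : ∂ (ev X₁ * z.el - ev (X₂ ^ 9) * y₃.el) = ev (X₁ ^ 16) + ev X₁ * quadPart := by
    rw [map_sub, derivation_ev, derivation_ev, derivation_y₃, derivation_el, diff_z]
    simp only [mul_add, ← map_mul]
    rw [show (X₁ * X₂ ^ 12 : EvenPoly (deg (V := V))) = X₂ ^ 9 * (X₁ * X₂ ^ 3) by ring,
      show (X₁ ^ 16 : EvenPoly (deg (V := V))) = X₁ * X₁ ^ 15 by ring]
    abel
  set w := ev X₁ * z.el - ev (X₂ ^ 9) * y₃.el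
  -- The factor x₁¹⁶ - x₁q is closed and conjugate to `d w`; as q² = 0 the product is x₁³².
  refine ⟨ev (X₁ ^ 16) * w - ev X₁ * (quadPart * w), ?_⟩
  rw [map_sub, derivation_ev, derivation_ev, derivation_mul _ _ _ hmem, hdq, hw, zero_mul,
    zero_add, sign_even (by decide), mul_add, mul_add, mul_ev_mul quadPart, quadPart_mul_self,
    mul_zero, add_zero, ev_comm _ quadPart, mul_ev_mul, add_sub_cancel_right, ← map_mul,
    ← pow_add]

theorem Xv_pow_mem (v : V) : Xv v ^ 12 ∈ exact G := by
  classical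
  set p : EvenPoly (deg (V := V)) := ∑ w with G.Adj v w, Xv v * Xv w with hp
  have h : Xv v ^ 3 - -(X₂ ^ 4 * p) ∈ exact G := by
    refine ⟨(zv v).el, ?_⟩
    rw [derivation_el, diff, sub_neg_eq_add, map_add, map_pow, ev_Xv, hp, Finset.mul_sum, map_sum]
    congr 1
    refine Finset.sum_congr (by congr) fun w _ => ?_
    rw [mul_comm, map_mul, map_mul, map_pow, ev_Xv, ev_Xv, ev_X₂]
  -- The fourth power is the first for which x₂⁴ raised to it, here x₂¹⁶, is divisible by the exact
  -- x₂¹³.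
  have h1 := Ideal.mem_of_dvd _ (sub_dvd_pow_sub_pow (Xv v ^ 3) (-(X₂ ^ 4 * p)) 4) h
  have h2 : (-(X₂ ^ 4 * p)) ^ 4 ∈ exact G := by
    rw [show (-(X₂ ^ 4 * p)) ^ 4 = X₂ ^ 3 * p ^ 4 * X₂ ^ 13 by ring]
    exact Ideal.mul_mem_left _ _ (X₂_pow_mem G)
  have h3 := add_mem h1 h2
  rwa [sub_add_cancel, ← pow_mul] at h3

theorem nilpotent (i : Gen V) (hi : Even (deg i)) : ∃ k, 0 < k ∧ ∃ w, ∂ w = i.el ^ k := by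
  cases i with
  | x₁ =>
    obtain ⟨w, hw⟩ := X₁_pow_mem G
    exact ⟨32, by decide, w, by rw [hw, map_pow, ev_X₁]⟩
  | x₂ =>
    obtain ⟨w, hw⟩ := X₂_pow_mem G
    exact ⟨13, by decide, w, by rw [hw, map_pow, ev_X₂]⟩
  | xv v =>
    obtain ⟨w, hw⟩ := Xv_pow_mem G v
    exact ⟨12, by decide, w, by rw [hw, map_pow, ev_Xv]⟩
  | y₁ | y₂ | y₃ | z | zv => simp [deg, Nat.even_iff] at hi

end Gen

/-! ### The four properties of the graph algebra -/

section Graph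

variable {V : Type u} [Fintype V] (G : SimpleGraph V)

theorem graphAlgebra_hasFormalDimension :
    (graphAlgebra G).HasFormalDimension (208 + 80 * Fintype.card V) :=
  FreeCGA.hasFormalDimension _ _ (Gen.diff_closed G) Gen.two_le_deg (Gen.diff_even G)
    (Gen.nilpotent G) Gen.sum_deg

theorem graphGenerators_finite (r : ℕ) : Module.Finite ℚ (graphGenerators G r) :=
  Module.Finite.span_of_finite ℚ (Set.Finite.subset (Set.finite_range (Gen.el (V := V)))
    (by rintro _ ⟨i, -, rfl⟩; exact ⟨i, rfl⟩))

theorem graphGenerators_eq_bot {r : ℕ} (h : ∀ i : Gen V, Gen.deg i ≠ r) :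
    graphGenerators G r = ⊥ := by
  rw [graphGenerators, Submodule.span_eq_bot]
  rintro _ ⟨i, hi, -⟩
  exact absurd hi (h i)

theorem graphAlgebra_isSullivan : (graphAlgebra G).IsSullivan (graphGenerators G) where
  simply_connected r hr := graphGenerators_eq_bot G fun i hi => by
    have := Gen.two_le_deg i; omega
  finite_type := graphGenerators_finite G
  free := by
    refine ⟨Gen V, Gen.deg, Gen.el, fun i => FreeCGA.gen_mem i, fun r => rfl, ?_⟩
    -- On its own generators the canonical map is the identity, hence bijective.
    have h : FreeCGA.lift (deg := Gen.deg (V := V)) (A := FreeCGA (Gen.deg (V := V))) Gen.el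
        (fun i j => FreeCGA.comm (FreeCGA.gen_mem i) (FreeCGA.gen_mem j)) =
        AlgHom.id ℚ (FreeCGA (Gen.deg (V := V))) :=
      FreeCGA.hom_ext fun i => FreeCGA.lift_gen _ _ i
    have hb : Function.Bijective (FreeCGA.lift (deg := Gen.deg (V := V))
        (A := FreeCGA (Gen.deg (V := V))) Gen.el
        (fun i j => FreeCGA.comm (FreeCGA.gen_mem i) (FreeCGA.gen_mem j))) := by
      rw [h]; exact Function.bijective_id
    exact hb
  d_lower r w hw := by
    induction hw using Submodule.span_induction with
    | mem a ha =>
      obtain ⟨i, rfl, rfl⟩ := ha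
      have h := Gen.diff_mem_adjoin G i
      rw [← Gen.derivation_el] at h
      refine Algebra.adjoin_mono ?_ h
      rintro _ ⟨j, hj, rfl⟩
      exact ⟨_, hj, Submodule.subset_span ⟨j, rfl, rfl⟩⟩
    | zero => rw [map_zero]; exact zero_mem _
    | add a b _ _ h1 h2 => rw [map_add]; exact add_mem h1 h2
    | smul q a _ h1 => rw [map_smul]; exact Subalgebra.smul_mem _ h1 q

theorem graphAlgebra_isMinimal : (graphAlgebra G).IsMinimal (graphGenerators G) := by
  intro r w hw
  induction hw using Submodule.span_induction with
  | mem a ha =>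
    obtain ⟨i, rfl, rfl⟩ := ha
    have hW : ∀ i : Gen V, (show graphAlgebra G from i.el) ∈ ⨆ s, graphGenerators G s :=
      fun i => Submodule.mem_iSup_of_mem (Gen.deg i) (Submodule.subset_span ⟨i, rfl, rfl⟩)
    have h := Gen.diff_mem_decomposable G hW i
    rw [← Gen.derivation_el] at h
    exact h
  | zero => rw [map_zero]; exact zero_mem _
  | add a b _ _ h1 h2 => rw [map_add]; exact add_mem h1 h2
  | smul q a _ h1 => rw [map_smul]; exact Submodule.smul_mem _ q h1

theorem graphAlgebra_isElliptic : (graphAlgebra G).IsElliptic (graphGenerators G) where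
  finite_generators := by
    have := graphGenerators_finite G
    -- 119 is the largest degree of a generator.
    refine finite_directSum 119 fun r hr => ?_
    rw [graphGenerators_eq_bot G fun i hi => ?_]
    · exact inferInstanceAs (Subsingleton (⊥ : Submodule ℚ (graphAlgebra G)))
    · cases i <;> simp [Gen.deg] at hi <;> omega
  finite_cohomology :=
    have h := graphAlgebra_hasFormalDimension G
    have := h.finite
    finite_directSum _ h.vanish

end Graph

end RatHom

theorem mainTheorem7 {V : Type u} [Fintype V] [Nontrivial V] (G : SimpleGraph V)
    (hG : G.Connected) :
    (RatHom.graphAlgebra G).IsSullivan (RatHom.graphGenerators G) ∧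
    (RatHom.graphAlgebra G).IsMinimal (RatHom.graphGenerators G) ∧
    (RatHom.graphAlgebra G).IsElliptic (RatHom.graphGenerators G) ∧
    (RatHom.graphAlgebra G).HasFormalDimension (208 + 80 * Fintype.card V) :=
  ⟨RatHom.graphAlgebra_isSullivan G, RatHom.graphAlgebra_isMinimal G,
    RatHom.graphAlgebra_isElliptic G, RatHom.graphAlgebra_hasFormalDimension G⟩
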